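/- **Conventions.** Terms are *-polynomials with complex coefficients (without constant term) in finitely many non-commuting variables. Formulas are built recursively: $\|t\|$ is a formula for each term $t$; if $\varphi,\psi$ are formulas and $f\colon[0,\infty)^2\to[0,\infty)$ is continuous, then $f(\varphi,\psi)$ is a formula; and if $\varphi$ is a formula and $k\in\mathbb N$, then $\inf_{\|x\|\le k}\varphi$ and $\sup_{\|x\|\le k}\varphi$ are formulas. An $n$-ary formula $\varphi(x_1,\dots,x_n)$ has a value $\varphi(\bar a)^A\in[0,\infty)$ at every $n$-tuple $\bar a$ of elements of a C*-algebra $A$. An $n$-type is a set of conditions $\varphi\le r$ or $\varphi\ge r$ with $\varphi$ an $n$-ary formula and $r\ge0$ real. It is realized in $A$ by a tuple $\bar a$ of elements of the unit ball of $A$ if $\bar a$ satisfies all its conditions, and $A$ omits it if no such tuple realizes it. C*-algebras are not assumed to be unital. A C*-algebra $A$ is *locally matricial* (LM) if for every finite $F\subseteq A$ and every $\varepsilon>0$ there are $k\ge1$ and a *-homomorphism $M_k(\mathbb C)\to A$ such that every element of $F$ is within $\varepsilon$ of its range. **Theorem.** There are countably many types such that a separable C*-algebra is LM if and only if it omits all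 of them. More precisely, there are $n$-ary formulas $\beta_{k,n}$ $(k,n\in\mathbb N)$ such that: 1. for every C*-algebra $A$ and all $a_1,\dots,a_n$ in the unit ball of $A$, $$\beta_{k,n}(a_1,\dots,a_n)^A=\inf_C\max_{1\le i\le n}\operatorname{dist}(a_i,C),$$ where $C$ ranges over the isomorphic copies of $M_k(\mathbb C)$ in $A$ (that is, the ranges of injective *-homomorphisms $M_k(\mathbb C)\to A$), the infimum is taken in $[0,1]$ (so it is $1$ if there is no copy), the maximum over the empty tuple is $0$, and $M_0(\mathbb C)=\{0\}$; 2. if, for $m,n\ge1$, $\mathbf t_{m,n}$ is the $n$-type consisting of the conditions $\beta_{k,n}(x_1,\dots,x_n)\ge 1/m$ for all $k\ge0$ and $\|x_i\|\le1$ for $1\le i\le n$, then a separable C*-algebra $A$ is LM if and only if it omits $\mathbf t_{m,n}$ for all $m,n\ge1$. -/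

import Mathlib

open scoped NNReal

universe u

namespace CStarLogic

/-- Terms: complex *-polynomials in `n` non-commuting variables. There is no constant term other
than zero, because the algebras need not be unital. -/
inductive StarPoly (n : ℕ) : Type
  | var (i : Fin n) : StarPoly n
  | zero : StarPoly n
  | add (s t : StarPoly n) : StarPoly n
  | mul (s t : StarPoly n) : StarPoly n
  | smul (c : ℂ) (t : StarPoly n) : StarPoly n
  | adj (t : StarPoly n) : StarPoly n

/-- Formulas whose free variables are among `n` given ones. The connectives are the continuous
functions `[0,∞)² → [0,∞)`; the quantifiers `infBall k` and `supBall k` are the infimum and the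
supremum over the ball `‖x‖ ≤ k`, and bind the last variable of the formula they are applied to. -/
inductive Formula : ℕ → Type
  | atomic {n : ℕ} (t : StarPoly n) : Formula n
  | conn {n : ℕ} (f : C(ℝ≥0 × ℝ≥0, ℝ≥0)) (φ ψ : Formula n) : Formula n
  | infBall {n : ℕ} (k : ℕ) (φ : Formula (n + 1)) : Formula n
  | supBall {n : ℕ} (k : ℕ) (φ : Formula (n + 1)) : Formula n

section Interpretation

variable {A : Type*} [NonUnitalCStarAlgebra A]

/-- The value of a term at a tuple of elements of a C*-algebra. -/
noncomputable def StarPoly.eval {n : ℕ} : StarPoly n → (Fin n → A) → A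
  | .var i, a => a i
  | .zero, _ => 0
  | .add s t, a => s.eval a + t.eval a
  | .mul s t, a => s.eval a * t.eval a
  | .smul c t, a => c • t.eval a
  | .adj t, a => star (t.eval a)

/-- The value of a formula at a tuple of elements of a C*-algebra. Since every formula is bounded
on bounded sets, the supremum is a genuine one. -/
noncomputable def Formula.eval : {n : ℕ} → Formula n → (Fin n → A) → ℝ≥0
  | _, .atomic t, a => ‖t.eval a‖₊
  | _, .conn f φ ψ, a => f (φ.eval a, ψ.eval a)
  | n, .infBall k φ, a => ⨅ x : {x : A // ‖x‖ ≤ k},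
      φ.eval (Fin.snoc (α := fun _ : Fin (n + 1) => A) a x.1)
  | n, .supBall k φ, a => ⨆ x : {x : A // ‖x‖ ≤ k},
      φ.eval (Fin.snoc (α := fun _ : Fin (n + 1) => A) a x.1)

end Interpretation

/-- Conditions `φ ≤ r` and `φ ≥ r` in `n` free variables. -/
inductive Condition (n : ℕ) : Type
  | le (φ : Formula n) (r : ℝ≥0) : Condition n
  | ge (φ : Formula n) (r : ℝ≥0) : Condition n

/-- An `n`-type (over the empty set, not necessarily complete) is a set of `n`-ary conditions. -/
abbrev NType (n : ℕ) : Type := Set (Condition n)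

section Realization

variable {A : Type*} [NonUnitalCStarAlgebra A]

/-- The tuple `a` satisfies the inequality expressed by the condition. -/
def Condition.Holds {n : ℕ} : Condition n → (Fin n → A) → Prop
  | .le φ r, a => φ.eval a ≤ r
  | .ge φ r, a => r ≤ φ.eval a

/-- A tuple realizes a type if it lies in the unit ball and satisfies all conditions. -/
def NType.IsRealizedBy {n : ℕ} (t : NType n) (a : Fin n → A) : Prop :=
  (∀ i, ‖a i‖ ≤ 1) ∧ ∀ c ∈ t, c.Holds a

end Realization

/-- The C*-algebra `A` omits the type `t`: no tuple of `A` realizes it. -/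
def Omits (A : Type*) [NonUnitalCStarAlgebra A] {n : ℕ} (t : NType n) : Prop :=
  ¬ ∃ a : Fin n → A, t.IsRealizedBy a

/-- `A` is locally matricial: for every finite subset `F` of `A` and every `ε > 0` there are
`k ≥ 1` and a *-homomorphism of `M_k(ℂ)` into `A` whose range comes within `ε` of all elements
of `F`. -/
def LocallyMatricial (A : Type*) [NonUnitalCStarAlgebra A] : Prop :=
  ∀ F : Finset A, ∀ ε : ℝ, 0 < ε →
    ∃ k : ℕ, 1 ≤ k ∧ ∃ Φ : Matrix (Fin k) (Fin k) ℂ →⋆ₙₐ[ℂ] A,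
      ∀ a ∈ F, ∃ b, ‖a - Φ b‖ < ε

/-- `inf_C max_i dist (a_i, C)`, where `C` ranges over the isomorphic copies of `M_k(ℂ)` in `A`,
that is, the ranges of injective *-homomorphisms `M_k(ℂ) → A`. For tuples of the unit ball the
maximum is at most `1` for every copy (as `0 ∈ C`), so that the infimum is one in `[0,1]`: adding
`1` to the set has no effect if there is a copy, and gives the value `1` if there is none.
The maximum over the empty tuple is `0`. The only copy of `M_0(ℂ) = 0` is the subalgebra `0`. -/
noncomputable def matrixDist {A : Type*} [NonUnitalCStarAlgebra A] (k : ℕ) {n : ℕ}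
    (a : Fin n → A) : ℝ :=
  sInf (insert 1 {r : ℝ | ∃ Φ : Matrix (Fin k) (Fin k) ℂ →⋆ₙₐ[ℂ] A,
    Function.Injective Φ ∧ r = ⨆ i, Metric.infDist (a i) (Set.range Φ)})

/-- The `n`-type consisting of the conditions `β_{k,n} ≥ 1/m` for all `k`, and `‖x_i‖ ≤ 1` for
all `i`. -/
def farType (β : ℕ → (n : ℕ) → Formula n) (m n : ℕ) : NType n :=
  {c | (∃ k : ℕ, c = .ge (β k n) (1 / (m : ℝ≥0))) ∨
    ∃ i : Fin n, c = .le (.atomic (.var i)) 1}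

end CStarLogic

namespace CStarLogic

/-! A copy of M_k(ℂ), with its matrix units, is determined by the column v_i = e_{i0}, and columns
are described by finitely many *-polynomial equations: v_i* v_j = δ_ij v_0. An element y lies in the
copy exactly when y = ∑ v_i (v_i* y v_j) v_j* and every compression v_i* y v_j is a scalar multiple
of v_0. That a self-adjoint h in a corner pAp is scalar can be tested by norms alone, since ‖4p + h‖
and ‖4p - h‖ give the two ends of its spectrum when ‖h‖ ≤ 4. So `copyDefect`, a finite sum of norms
and truncated differences, vanishes on genuine copies and is a formula.

These conditions are stable (`exists_copy_near`): tuples x, y in the unit ball with small defect d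
are close to a genuine copy and elements of it, within K d, where K depends on k but not on the
algebra. Almost projections are corrected by functional calculus, and the other entries of the
column one at a time by Gram–Schmidt and polar decomposition (`exists_column_near_aux`).

Linear stability makes the constrained infimum over copies equal to an unconstrained one: the
distance is the minimum of 1 and the infimum, over x, y in the unit ball, of max ‖a_l - 2 y_l‖ + K
d. A genuine copy gives d = 0; conversely, moving to a nearby copy costs at most K d. This is
`exists_formula_eval_eq_matrixDist`. Omitting the types then says that every finite tuple of the
unit ball is arbitrarily close to some copy, and `locallyMatricial_iff` removes the normalization.
-/

/-! ### Functional calculus: almost projections and almost partial isometries -/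

/-- A continuous function that is `0` on `(-∞, 1/4]` and `1` on `[3/4, ∞)`. -/
noncomputable def cutoff (t : ℝ) : ℝ := max 0 (min 1 (2 * t - 1 / 2))

/-- A continuous function that is `0` on `(-∞, 1/4]` and `1 / √t` on `[3/4, ∞)`. -/
noncomputable def cutoffInvSqrt (t : ℝ) : ℝ := cutoff t / √(max t (1 / 2))

lemma continuous_cutoff : Continuous cutoff := by
  unfold cutoff; fun_prop

lemma continuous_cutoffInvSqrt : Continuous cutoffInvSqrt := by
  unfold cutoffInvSqrt
  refine continuous_cutoff.div (by fun_prop) fun t => ?_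
  have : (0 : ℝ) < max t (1 / 2) := lt_max_of_lt_right (by norm_num)
  positivity

lemma cutoff_of_le {t : ℝ} (ht : t ≤ 1 / 4) : cutoff t = 0 :=
  max_eq_left ((min_le_right _ _).trans (by linarith))

lemma cutoff_of_ge {t : ℝ} (ht : 3 / 4 ≤ t) : cutoff t = 1 := by
  rw [cutoff, min_eq_left (by linarith), max_eq_right zero_le_one]

lemma cutoffInvSqrt_of_le {t : ℝ} (ht : t ≤ 1 / 4) : cutoffInvSqrt t = 0 := by
  rw [cutoffInvSqrt, cutoff_of_le ht, zero_div]

lemma cutoffInvSqrt_of_ge {t : ℝ} (ht : 3 / 4 ≤ t) : cutoffInvSqrt t = 1 / √t := by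
  rw [cutoffInvSqrt, cutoff_of_ge ht, max_eq_left (by linarith)]

/-- Strictly between 1/4 and 3/4 the value of t - t² exceeds 3/16. The spectrum of an almost
idempotent element therefore avoids the interval where `cutoff` is neither 0 nor 1. -/
lemma le_or_ge_of_abs_mul_self_sub_self_le {t : ℝ} (ht : |t * t - t| ≤ 1 / 16) :
    t ≤ 1 / 4 ∨ 3 / 4 ≤ t := by
  by_contra! h
  have := abs_le.1 ht
  nlinarith [h.1, h.2]

section

variable {A : Type*} [NonUnitalCStarAlgebra A]

lemma abs_mul_self_sub_self_le_of_mem_quasispectrum {h : A} (hh : IsSelfAdjoint h) {ε : ℝ}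
    (hε : ‖h * h - h‖ ≤ ε) {t : ℝ} (ht : t ∈ quasispectrum ℝ h) : |t * t - t| ≤ ε := by
  have e : cfcₙ (fun t : ℝ => t * t - t) h = h * h - h := by
    rw [cfcₙ_sub (fun t : ℝ => t * t) (fun t => t) h, cfcₙ_mul (fun t : ℝ => t) (fun t => t) h,
      cfcₙ_id' ℝ h]
  have := norm_apply_le_norm_cfcₙ (𝕜 := ℝ) (fun t : ℝ => t * t - t) h ht
  rw [e] at this
  exact this.trans hε

/-- An almost idempotent self-adjoint element `h` is close to a projection `p`, and there is an
inverse square root of `h` relative to `p`. -/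
lemma exists_isStarProjection_near {h : A} (hh : IsSelfAdjoint h) {ε : ℝ} (hε : ‖h * h - h‖ ≤ ε)
    (hε' : ε ≤ 1 / 16) :
    ∃ p f : A, IsStarProjection p ∧ IsSelfAdjoint f ∧ ‖h - p‖ ≤ 2 * ε ∧
      f * h * f = p ∧ h * (f * f) = p ∧ ‖(p - f) * h * (p - f)‖ ≤ (2 * ε) ^ 2 := by
  have sp : ∀ t ∈ quasispectrum ℝ h, |t * t - t| ≤ ε ∧ (t ≤ 1 / 4 ∨ 3 / 4 ≤ t) := fun t ht =>
    have h1 := abs_mul_self_sub_self_le_of_mem_quasispectrum hh hε ht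
    ⟨h1, le_or_ge_of_abs_mul_self_sub_self_le (h1.trans hε')⟩
  have c1 := continuous_cutoff
  have c2 := continuous_cutoffInvSqrt
  have z1 : cutoff 0 = 0 := cutoff_of_le (by norm_num)
  have z2 : cutoffInvSqrt 0 = 0 := cutoffInvSqrt_of_le (by norm_num)
  have key : ∀ t : ℝ, 3 / 4 ≤ t → √t * √t = t ∧ 0 < √t := fun t ht =>
    ⟨Real.mul_self_sqrt (by linarith), Real.sqrt_pos.2 (by linarith)⟩
  refine ⟨cfcₙ cutoff h, cfcₙ cutoffInvSqrt h, ⟨?_, cfcₙ_predicate _ _⟩, cfcₙ_predicate _ _, ?_,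
    ?_, ?_, ?_⟩
  · rw [IsIdempotentElem, ← cfcₙ_mul cutoff cutoff h c1.continuousOn z1 c1.continuousOn z1]
    refine cfcₙ_congr fun t ht => ?_
    rcases (sp t ht).2 with h1 | h1
    · simp [cutoff_of_le h1]
    · simp [cutoff_of_ge h1]
  · have : h - cfcₙ cutoff h = cfcₙ (fun t => t - cutoff t) h := by
      rw [cfcₙ_sub (fun t : ℝ => t) cutoff h (by fun_prop) rfl c1.continuousOn z1, cfcₙ_id' ℝ h]
    rw [this]
    refine norm_cfcₙ_le fun t ht => ?_
    obtain ⟨h2, h1⟩ := sp t ht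
    rw [Real.norm_eq_abs]
    have e : t * t - t = t * (t - 1) := by ring
    rw [e, abs_mul] at h2
    rcases h1 with h1 | h1
    · rw [cutoff_of_le h1, sub_zero]
      -- Of the two factors of t(t - 1), the one that is not small is at least 3/4, so the other is
      -- at most 4ε/3.
      have : 3 / 4 ≤ |t - 1| := by rw [abs_sub_comm]; exact le_trans (by linarith) (le_abs_self _)
      nlinarith [abs_nonneg t]
    · rw [cutoff_of_ge h1]
      have : 3 / 4 ≤ |t| := h1.trans (le_abs_self _)
      nlinarith [abs_nonneg (t - 1)]
  · have : cfcₙ cutoffInvSqrt h * h * cfcₙ cutoffInvSqrt h =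
        cfcₙ (fun t => cutoffInvSqrt t * t * cutoffInvSqrt t) h := by
      rw [cfcₙ_mul (fun t => cutoffInvSqrt t * t) cutoffInvSqrt h (by fun_prop) (by simp)
        (by fun_prop) z2, cfcₙ_mul cutoffInvSqrt (fun t : ℝ => t) h (by fun_prop) z2, cfcₙ_id' ℝ h]
    rw [this]
    refine cfcₙ_congr fun t ht => ?_
    rcases (sp t ht).2 with h1 | h1
    · simp [cutoff_of_le h1, cutoffInvSqrt_of_le h1]
    · obtain ⟨k1, k2⟩ := key t h1
      simp only [cutoff_of_ge h1, cutoffInvSqrt_of_ge h1]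
      field_simp
      rw [sq, k1]
  · have : h * (cfcₙ cutoffInvSqrt h * cfcₙ cutoffInvSqrt h) =
        cfcₙ (fun t => t * (cutoffInvSqrt t * cutoffInvSqrt t)) h := by
      rw [cfcₙ_mul (fun t : ℝ => t) (fun t => cutoffInvSqrt t * cutoffInvSqrt t) h (by fun_prop)
        rfl (by fun_prop) (by simp [z2]),
        cfcₙ_mul cutoffInvSqrt cutoffInvSqrt h (by fun_prop) z2 (by fun_prop) z2, cfcₙ_id' ℝ h]
    rw [this]
    refine cfcₙ_congr fun t ht => ?_
    rcases (sp t ht).2 with h1 | h1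
    · simp [cutoff_of_le h1, cutoffInvSqrt_of_le h1]
    · obtain ⟨k1, k2⟩ := key t h1
      simp only [cutoff_of_ge h1, cutoffInvSqrt_of_ge h1]
      field_simp
      rw [sq, k1]
  · rw [← cfcₙ_sub cutoff cutoffInvSqrt h (by fun_prop) z1 (by fun_prop) z2]
    set g : ℝ → ℝ := fun t => cutoff t - cutoffInvSqrt t with hg
    have cg : Continuous g := by fun_prop
    have zg : g 0 = 0 := by simp [hg, z1, z2]
    have : cfcₙ g h * h * cfcₙ g h = cfcₙ (fun t => g t * t * g t) h := by
      rw [cfcₙ_mul (fun t => g t * t) g h (by fun_prop) (by simp)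
        (by fun_prop) zg, cfcₙ_mul g (fun t : ℝ => t) h (by fun_prop) zg, cfcₙ_id' ℝ h]
    rw [this]
    refine norm_cfcₙ_le fun t ht => ?_
    obtain ⟨h2, h1⟩ := sp t ht
    rcases h1 with h1 | h1
    · simp only [hg, cutoff_of_le h1, cutoffInvSqrt_of_le h1]
      simp only [sub_self, mul_zero, norm_zero]
      positivity
    · obtain ⟨k1, k2⟩ := key t h1
      simp only [hg, cutoff_of_ge h1, cutoffInvSqrt_of_ge h1]
      have e : (1 - 1 / √t) * t * (1 - 1 / √t) = (√t - 1) ^ 2 := by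
        field_simp
        rw [sq (√t), k1, mul_comm]
      rw [e, Real.norm_eq_abs, abs_of_nonneg (sq_nonneg _), ← sq_abs]
      refine pow_le_pow_left₀ (abs_nonneg _) ?_ 2
      -- Here t ≥ 3/4 and √t + 1 ≥ 1, so |√t - 1| is controlled by |t² - t|.
      have e2 : t * t - t = t * ((√t + 1) * (√t - 1)) := by
        have : (√t + 1) * (√t - 1) = √t * √t - 1 := by ring
        rw [this, k1]; ring
      rw [e2, abs_mul, abs_mul, abs_of_pos (by linarith : 0 < t),
        abs_of_pos (by linarith : 0 < √t + 1)] at h2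
      have : 3 / 4 * |√t - 1| ≤ t * ((√t + 1) * |√t - 1|) := by
        have := abs_nonneg (√t - 1)
        gcongr
        nlinarith
      nlinarith [abs_nonneg (√t - 1)]

/-- Polar decomposition of an element `y = y p` for which `y* y` is close to the projection `p`. -/
lemma exists_mul_star_mul_self_eq {p y : A} (hp : IsStarProjection p) (hy : y * p = y) {ε : ℝ}
    (hε : ‖star y * y - p‖ ≤ ε) (hε' : ε ≤ 1 / 32) :
    ∃ f : A, star (y * f) * (y * f) = p ∧ ‖y - y * f‖ ≤ 4 * ε := by
  set h := star y * y with hh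
  have hps : star p = p := hp.isSelfAdjoint.star_eq
  have hpp : p * p = p := hp.isIdempotentElem.eq
  have hsa : IsSelfAdjoint h := .star_mul_self y
  have hhp : h * p = h := by rw [hh, mul_assoc, hy]
  have hph : p * h = h := by
    have := congrArg star hhp
    rwa [star_mul, hps, hsa.star_eq] at this
  have hε0 : 0 ≤ ε := (norm_nonneg _).trans hε
  have hp1 : ‖p‖ ≤ 1 := IsStarProjection.norm_le p hp
  have hh2 : ‖h‖ ≤ 2 := by
    have := norm_add_le (h - p) p
    rw [sub_add_cancel] at this
    linarith
  have hidem : ‖h * h - h‖ ≤ 2 * ε := by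
    have : h * h - h = h * (h - p) := by rw [mul_sub, hhp]
    rw [this]
    calc _ ≤ ‖h‖ * ‖h - p‖ := norm_mul_le _ _
      _ ≤ 2 * ε := by gcongr
  obtain ⟨q, f, hq, hf, hhq, hfhf, hhff, hdist⟩ :=
    exists_isStarProjection_near hsa hidem (by linarith)
  have hpq : p * q = q := by rw [← hhff, ← mul_assoc, hph]
  have hqp : q * p = q := by
    have := congrArg star hpq
    rwa [star_mul, hps, hq.isSelfAdjoint.star_eq] at this
  -- Since `q` is a subprojection of `p`, the difference is a projection and has norm 0 or 1; the
  -- norm is at most 5ε < 1.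
  have hpeq : p = q := by
    have e1 : star (p - q) * (p - q) = p - q := by
      rw [star_sub, hps, hq.isSelfAdjoint.star_eq, mul_sub, sub_mul, sub_mul, hpp, hpq, hqp,
        hq.isIdempotentElem.eq]
      abel
    have e2 := CStarRing.norm_star_mul_self (x := p - q)
    rw [e1] at e2
    have e3 : ‖p - q‖ ≤ ε + 2 * (2 * ε) := by
      have := norm_sub_le_norm_sub_add_norm_sub p h q
      rw [norm_sub_rev p h] at this
      linarith
    have e4 : ‖p - q‖ = 0 := by
      by_contra h0
      have : ‖p - q‖ = 1 := mul_left_cancel₀ h0 (by rw [← e2, mul_one])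
      linarith
    exact sub_eq_zero.1 (norm_eq_zero.1 e4)
  subst hpeq
  refine ⟨f, ?_, ?_⟩
  · rw [star_mul, hf.star_eq, ← hfhf, hh]
    simp only [mul_assoc]
  · have e : y - y * f = y * (p - f) := by rw [mul_sub, hy]
    -- By the C*-identity the squared distance is ‖(p - f) h (p - f)‖, which is at most (2 · 2ε)²,
    -- as `h` is idempotent up to 2ε.
    refine abs_le_of_sq_le_sq' ?_ (by positivity) |>.2
    rw [sq, ← CStarRing.norm_star_mul_self, e, star_mul, star_sub, hps, hf.star_eq]
    have : (p - f) * star y * (y * (p - f)) = (p - f) * h * (p - f) := by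
      rw [hh]; simp only [mul_assoc]
    rw [this]
    refine hdist.trans (le_of_eq (by ring))

end
-- Stability of the relations for a column of matrix units
section

variable {A : Type*} [NonUnitalCStarAlgebra A]

lemma isStarProjection_of_star_mul_self_eq {p : A} (h : star p * p = p) : IsStarProjection p := by
  have hs : star p = p := by
    conv_rhs => rw [← h]
    conv_lhs => rw [← h]
    rw [star_mul, star_star]
  exact ⟨by rw [IsIdempotentElem]; rwa [hs] at h, hs⟩

lemma norm_le_one_of_star_mul_self_eq {p v : A} (hp : IsStarProjection p) (h : star v * v = p) :
    ‖v‖ ≤ 1 := by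
  have h1 := CStarRing.norm_star_mul_self (x := v)
  have h2 := IsStarProjection.norm_le p hp
  rw [h] at h1
  nlinarith [norm_nonneg v]

/-- C*-identity: the square (vp - v)*(vp - v) expands to p - p - p + p. -/
lemma mul_eq_self_of_star_mul_self_eq {p v : A} (hp : IsStarProjection p) (h : star v * v = p) :
    v * p = v := by
  have hps : star p = p := hp.isSelfAdjoint.star_eq
  have hpp : p * p = p := hp.isIdempotentElem.eq
  refine (sub_eq_zero.1 (CStarRing.star_mul_self_eq_zero_iff _ |>.1 ?_))
  rw [star_sub, star_mul, hps, sub_mul, mul_sub, mul_sub, mul_assoc p, ← mul_assoc (star v) v p,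
    mul_assoc p, h, hpp, hpp]
  simp

/-- Almost projections in the unit ball are close to projections. -/
lemma exists_star_mul_self_eq_near {x : A} (hx : ‖x‖ ≤ 1) {r : ℝ} (hr : ‖star x * x - x‖ ≤ r)
    (hr' : r ≤ 1 / 32) : ∃ p : A, star p * p = p ∧ ‖x - p‖ ≤ 5 * r := by
  set h := star x * x with hh
  have hr0 : 0 ≤ r := (norm_nonneg _).trans hr
  have hsa : IsSelfAdjoint h := .star_mul_self x
  have hh1 : ‖h‖ ≤ 1 := by
    rw [hh, CStarRing.norm_star_mul_self]
    nlinarith [norm_nonneg x]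
  have hidem : ‖h * h - h‖ ≤ 2 * r := by
    have e : h * h - h = star (h - x) * h + star x * (h - x) := by
      rw [star_sub, hsa.star_eq, sub_mul, mul_sub, ← hh]; abel
    rw [e]
    refine (norm_add_le _ _).trans ?_
    have h1 : ‖star (h - x) * h‖ ≤ r * 1 := (norm_mul_le _ _).trans (by rw [norm_star]; gcongr)
    have h2 : ‖star x * (h - x)‖ ≤ 1 * r := (norm_mul_le _ _).trans (by rw [norm_star]; gcongr)
    linarith
  obtain ⟨p, -, hp, -, hhp, -⟩ := exists_isStarProjection_near hsa hidem (by linarith)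
  refine ⟨p, by rw [hp.isSelfAdjoint.star_eq, hp.isIdempotentElem.eq], ?_⟩
  have := norm_sub_le_norm_sub_add_norm_sub x h p
  rw [norm_sub_rev x h] at this
  linarith

/-- One step of the Gram–Schmidt process: an exact column `v` can be prolonged by an element close
to a given `x` that almost satisfies the relations. -/
lemma exists_orthogonal_near {n : ℕ} {v : ℕ → A} {p x : A} (hp : IsStarProjection p)
    (hv : ∀ i < n, ∀ j < n, star (v i) * v j = if i = j then p else 0) (hx : ‖x‖ ≤ 1) {δ : ℝ}
    (hxp : ‖x * p - x‖ ≤ δ) (hxx : ‖star x * x - p‖ ≤ δ) (hvx : ∀ i < n, ‖star (v i) * x‖ ≤ δ)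
    (hδ : 128 * ((n + 1) * δ) ≤ 1) :
    ∃ w : A, star w * w = p ∧ (∀ i < n, star (v i) * w = 0) ∧ ‖x - w‖ ≤ 17 * ((n + 1) * δ) := by
  have hps : star p = p := hp.isSelfAdjoint.star_eq
  have hpp : p * p = p := hp.isIdempotentElem.eq
  have hp1 : ‖p‖ ≤ 1 := IsStarProjection.norm_le p hp
  have hδ0 : 0 ≤ δ := (norm_nonneg _).trans hxp
  have hvn : ∀ i < n, ‖v i‖ ≤ 1 := fun i hi =>
    norm_le_one_of_star_mul_self_eq hp (by rw [hv i hi i hi, if_pos rfl])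
  have hpv : ∀ i < n, p * star (v i) = star (v i) := fun i hi => by
    have := congrArg star (mul_eq_self_of_star_mul_self_eq hp
      (show star (v i) * v i = p by rw [hv i hi i hi, if_pos rfl]))
    rwa [star_mul, hps] at this
  -- Subtracting the components along the `v i` makes `y` exactly orthogonal to them. The polar part
  -- `y * f` stays orthogonal, because `f` multiplies on the right.
  set y : A := x * p - ∑ i ∈ Finset.range n, v i * (star (v i) * x * p) with hy
  set d : ℝ := (n + 1) * δ with hd
  have hδd : δ ≤ d := by rw [hd]; nlinarith [(Nat.cast_nonneg n : (0 : ℝ) ≤ n)]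
  have hyp : y * p = y := by
    rw [hy, sub_mul, Finset.sum_mul, mul_assoc x, hpp]
    congr 1
    refine Finset.sum_congr rfl fun i _ => ?_
    rw [mul_assoc (v i), mul_assoc (star (v i) * x), hpp]
  have hvy : ∀ i < n, star (v i) * y = 0 := fun i hi => by
    rw [hy, mul_sub, Finset.mul_sum, Finset.sum_eq_single i, ← mul_assoc (star (v i)) (v i),
      hv i hi i hi, if_pos rfl, ← mul_assoc p, ← mul_assoc p, hpv i hi, mul_assoc, sub_self]
    · intro j hj hji
      rw [← mul_assoc, hv i hi j (Finset.mem_range.1 hj), if_neg (Ne.symm hji), zero_mul]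
    · intro h; exact absurd (Finset.mem_range.2 hi) h
  have hyx : ‖y - x‖ ≤ d := by
    have e : y - x = (x * p - x) - ∑ i ∈ Finset.range n, v i * (star (v i) * x * p) := by
      rw [hy]; abel
    have hs : ‖∑ i ∈ Finset.range n, v i * (star (v i) * x * p)‖ ≤ n * δ := by
      refine (norm_sum_le _ _).trans ((Finset.sum_le_card_nsmul _ _ δ fun i hi => ?_).trans ?_)
      · have hi := Finset.mem_range.1 hi
        calc ‖v i * (star (v i) * x * p)‖ ≤ ‖v i‖ * (‖star (v i) * x‖ * ‖p‖) :=
            (norm_mul_le _ _).trans (by gcongr; exact norm_mul_le _ _)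
          _ ≤ 1 * (δ * 1) := by gcongr; exacts [hvn i hi, hvx i hi]
          _ = δ := by ring
      · simp
    rw [e, hd]
    refine (norm_sub_le _ _).trans ?_
    linarith
  have hyn : ‖y‖ ≤ 2 := by
    have := norm_add_le (y - x) x
    rw [sub_add_cancel] at this
    linarith
  have hyy : ‖star y * y - p‖ ≤ 4 * d := by
    have e : star y * y - p = star y * (y - x) + star (y - x) * x + (star x * x - p) := by
      clear_value y
      rw [star_sub, mul_sub, sub_mul]; abel
    rw [e]
    have h1 : ‖star y * (y - x)‖ ≤ 2 * d := (norm_mul_le _ _).trans (by rw [norm_star]; gcongr)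
    have h2 : ‖star (y - x) * x‖ ≤ d * 1 := (norm_mul_le _ _).trans (by rw [norm_star]; gcongr)
    have h3 := norm_add_le (star y * (y - x) + star (y - x) * x) (star x * x - p)
    have h4 := norm_add_le (star y * (y - x)) (star (y - x) * x)
    linarith
  obtain ⟨f, hf, hyf⟩ := exists_mul_star_mul_self_eq hp hyp hyy (by linarith)
  refine ⟨y * f, hf, fun i hi => by rw [← mul_assoc, hvy i hi, zero_mul], ?_⟩
  have := norm_sub_le_norm_sub_add_norm_sub x y (y * f)
  rw [norm_sub_rev x y] at this
  linarith

end

/-- The relations `x_i* x_j = δ_ij x_0`, `x_i x_0 = x_i` are stable, with a linear modulus that does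
not depend on the algebra. -/
lemma exists_column_near_aux (m : ℕ) : ∃ K : ℝ, 1 ≤ K ∧
    ∀ (A : Type u) [NonUnitalCStarAlgebra A] (x : ℕ → A) (r : ℝ), (∀ i ≤ m, ‖x i‖ ≤ 1) →
      (∀ i ≤ m, ∀ j ≤ m, ‖star (x i) * x j - if i = j then x 0 else 0‖ ≤ r) →
      (∀ i ≤ m, ‖x i * x 0 - x i‖ ≤ r) → K * r ≤ 1 →
      ∃ v : ℕ → A, (∀ i ≤ m, ∀ j ≤ m, star (v i) * v j = if i = j then v 0 else 0) ∧
        ∀ i ≤ m, ‖x i - v i‖ ≤ K * r := by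
  induction m with
  | zero =>
    refine ⟨32, by norm_num, fun A _ x r hx hxx _ hr => ?_⟩
    have h0 := hxx 0 le_rfl 0 le_rfl
    rw [if_pos rfl] at h0
    have hr0 : 0 ≤ r := (norm_nonneg _).trans h0
    obtain ⟨p, hp, hxp⟩ := exists_star_mul_self_eq_near (hx 0 le_rfl) h0 (by linarith)
    refine ⟨fun _ => p, fun i hi j hj => ?_, fun i hi => ?_⟩
    · rw [Nat.le_zero.1 hi, Nat.le_zero.1 hj, if_pos rfl, hp]
    · rw [Nat.le_zero.1 hi]; linarith
  | succ m ih =>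
    obtain ⟨K, hK, ih⟩ := ih
    have hm : (0 : ℝ) ≤ m := Nat.cast_nonneg m
    -- Replacing the first entries by the exact `v i` turns the error r into (K + 1) r. The
    -- orthogonalization step against m + 1 entries then needs 128 (m + 2)(K + 1) r ≤ 1 and moves
    -- the new entry by at most 17 (m + 2)(K + 1) r.
    refine ⟨128 * ((m + 1 + 1) * (K + 1)), by nlinarith, fun A _ x r hx hxx hx0 hr => ?_⟩
    have hr0 : 0 ≤ r := (norm_nonneg _).trans (hx0 0 (Nat.zero_le _))
    have hKr : K * r ≤ 128 * ((m + 1 + 1) * (K + 1)) * r := by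
      gcongr; nlinarith
    obtain ⟨v, hv, hxv⟩ := ih A x r (fun i hi => hx i (hi.trans m.le_succ))
      (fun i hi j hj => hxx i (hi.trans m.le_succ) j (hj.trans m.le_succ))
      (fun i hi => hx0 i (hi.trans m.le_succ)) (hKr.trans hr)
    have hp : IsStarProjection (v 0) := isStarProjection_of_star_mul_self_eq (by
      rw [hv 0 m.zero_le 0 m.zero_le, if_pos rfl])
    have hxv0 := hxv 0 m.zero_le
    set y := x (m + 1) with hy
    have hyn : ‖y‖ ≤ 1 := hx _ le_rfl
    have h1 : ‖y * v 0 - y‖ ≤ (K + 1) * r := by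
      have e : y * v 0 - y = (y * x 0 - y) - y * (x 0 - v 0) := by rw [mul_sub]; abel
      rw [e]
      have h1 := hx0 (m + 1) le_rfl
      have h2 : ‖y * (x 0 - v 0)‖ ≤ 1 * (K * r) := (norm_mul_le _ _).trans (by gcongr)
      have := norm_sub_le (y * x 0 - y) (y * (x 0 - v 0))
      linarith
    have h2 : ‖star y * y - v 0‖ ≤ (K + 1) * r := by
      have h1 := hxx (m + 1) le_rfl (m + 1) le_rfl
      rw [if_pos rfl] at h1
      have := norm_sub_le_norm_sub_add_norm_sub (star y * y) (x 0) (v 0)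
      linarith
    have h3 : ∀ i < m + 1, ‖star (v i) * y‖ ≤ (K + 1) * r := by
      intro i hi
      have h1 := hxx i (by omega) (m + 1) le_rfl
      rw [if_neg (by omega), sub_zero] at h1
      have e : star (v i) * y = star (x i) * y - star (x i - v i) * y := by
        rw [star_sub, sub_mul]; abel
      rw [e]
      have h2 : ‖star (x i - v i) * y‖ ≤ K * r * 1 :=
        (norm_mul_le _ _).trans (by rw [norm_star]; gcongr; exact hxv i (by omega))
      have := norm_sub_le (star (x i) * y) (star (x i - v i) * y)
      linarith
    have h4 : 128 * (((m + 1 : ℕ) + 1) * ((K + 1) * r)) ≤ 1 := by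
      push_cast
      calc _ = 128 * ((m + 1 + 1) * (K + 1)) * r := by ring
        _ ≤ 1 := hr
    obtain ⟨w, hw, hvw, hyw⟩ := exists_orthogonal_near (n := m + 1) (v := v) (x := y)
      (δ := (K + 1) * r) hp
      (fun i hi j hj => hv i (Nat.lt_succ_iff.1 hi) j (Nat.lt_succ_iff.1 hj)) hyn h1 h2 h3 h4
    push_cast at hyw
    refine ⟨Function.update v (m + 1) w, fun i hi j hj => ?_, fun i hi => ?_⟩
    · rw [Function.update_of_ne (Nat.succ_ne_zero m).symm]
      rcases Nat.le_succ_iff.1 hi with hi | rfl <;> rcases Nat.le_succ_iff.1 hj with hj | rfl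
      · rw [Function.update_of_ne (by omega), Function.update_of_ne (by omega), hv i hi j hj]
      · rw [Function.update_of_ne (by omega), Function.update_self, hvw i (by omega),
          if_neg (by omega)]
      · rw [Function.update_of_ne (a := j) (by omega), Function.update_self, if_neg (by omega)]
        have := congrArg star (hvw j (by omega))
        rwa [star_mul, star_star, star_zero] at this
      · simp [hw]
    · rcases Nat.le_succ_iff.1 hi with hi | rfl
      · rw [Function.update_of_ne (by omega)]
        exact (hxv i hi).trans hKr
      · rw [Function.update_self]
        refine hyw.trans ?_
        have : 0 ≤ (m + 1 + 1) * ((K + 1) * r) := by positivity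
        linarith

/-- A column of matrix units `v_i = e_{i0}` of a copy of `M_k(ℂ)`, possibly zero. -/
def IsColumn {A : Type*} [NonUnitalCStarAlgebra A] {k : ℕ} [NeZero k] (v : Fin k → A) : Prop :=
  ∀ i j, star (v i) * v j = if i = j then v 0 else 0

lemma exists_isColumn_near (k : ℕ) [NeZero k] : ∃ K : ℝ, 1 ≤ K ∧
    ∀ (A : Type u) [NonUnitalCStarAlgebra A] (x : Fin k → A) (r : ℝ), (∀ i, ‖x i‖ ≤ 1) →
      (∀ i j, ‖star (x i) * x j - if i = j then x 0 else 0‖ ≤ r) →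
      (∀ i, ‖x i * x 0 - x i‖ ≤ r) → K * r ≤ 1 →
      ∃ v : Fin k → A, IsColumn v ∧ ∀ i, ‖x i - v i‖ ≤ K * r := by
  obtain ⟨m, rfl⟩ := Nat.exists_eq_succ_of_ne_zero (NeZero.ne k)
  obtain ⟨K, hK, h⟩ := exists_column_near_aux.{u} m
  refine ⟨K, hK, fun A _ x r hx hxx hx0 hr => ?_⟩
  have hxx' : ∀ i ≤ m, ∀ j ≤ m, ‖star (x (Fin.ofNat (m + 1) i)) * x (Fin.ofNat (m + 1) j) -
      if i = j then x (Fin.ofNat (m + 1) 0) else 0‖ ≤ r := fun i hi j hj => by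
    have := hxx (Fin.ofNat (m + 1) i) (Fin.ofNat (m + 1) j)
    have e : (Fin.ofNat (m + 1) i = Fin.ofNat (m + 1) j) ↔ i = j := by
      simp [Fin.ext_iff, Nat.mod_eq_of_lt (Nat.lt_succ_iff.2 hi),
        Nat.mod_eq_of_lt (Nat.lt_succ_iff.2 hj)]
    simp only [e] at this
    exact this
  obtain ⟨v, hv, hxv⟩ := h A (fun i => x (Fin.ofNat (m + 1) i)) r (fun i _ => hx _) hxx'
    (fun i _ => hx0 _) hr
  refine ⟨fun i => v i, fun i j => ?_, fun i => ?_⟩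
  · simpa [Fin.ext_iff] using hv i (Nat.lt_succ_iff.1 i.2) j (Nat.lt_succ_iff.1 j.2)
  · simpa using hxv i (Nat.lt_succ_iff.1 i.2)

/-! ### Exact columns and *-homomorphisms on M_k(ℂ) -/

section
variable {A : Type*} [NonUnitalCStarAlgebra A] {k : ℕ} [NeZero k] {v : Fin k → A}

namespace IsColumn

lemma isStarProjection (hv : IsColumn v) : IsStarProjection (v 0) :=
  isStarProjection_of_star_mul_self_eq (by rw [hv, if_pos rfl])

lemma mul_zero_eq (hv : IsColumn v) (i : Fin k) : v i * v 0 = v i :=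
  mul_eq_self_of_star_mul_self_eq hv.isStarProjection (by rw [hv, if_pos rfl])

lemma zero_mul_star (hv : IsColumn v) (i : Fin k) : v 0 * star (v i) = star (v i) := by
  have := congrArg star (hv.mul_zero_eq i)
  rwa [star_mul, hv.isStarProjection.isSelfAdjoint.star_eq] at this

lemma norm_le_one (hv : IsColumn v) (i : Fin k) : ‖v i‖ ≤ 1 :=
  norm_le_one_of_star_mul_self_eq hv.isStarProjection (by rw [hv, if_pos rfl])

lemma unit_mul_unit (hv : IsColumn v) (i j l m : Fin k) :
    v i * star (v j) * (v l * star (v m)) = if j = l then v i * star (v m) else 0 := by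
  rw [mul_assoc, ← mul_assoc (star (v j)), hv]
  split_ifs
  · rw [hv.zero_mul_star]
  · simp

/-- The *-homomorphism `M_k(ℂ) → A` sending the matrix unit `e_{ij}` to `v_i v_j*`. -/
noncomputable def hom (hv : IsColumn v) : Matrix (Fin k) (Fin k) ℂ →⋆ₙₐ[ℂ] A where
  toFun M := ∑ i, ∑ j, M i j • (v i * star (v j))
  map_smul' c M := by simp [Finset.smul_sum, mul_smul]
  map_zero' := by simp
  map_add' M N := by simp [add_smul, Finset.sum_add_distrib]
  map_mul' M N := by
    simp only [Finset.sum_mul, Finset.mul_sum, smul_mul_smul_comm, hv.unit_mul_unit,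
      Matrix.mul_apply, Finset.sum_smul, smul_ite, smul_zero]
    simp only [Finset.sum_ite_eq', Finset.mem_univ, if_true]
    exact (Finset.sum_congr rfl fun i _ => Finset.sum_comm).trans
      (Finset.sum_comm.trans (Finset.sum_congr rfl fun l _ => Finset.sum_comm))
  map_star' M := by
    simp only [star_sum, star_smul, star_mul, star_star, Matrix.star_apply]
    exact Finset.sum_comm

lemma hom_apply (hv : IsColumn v) (M : Matrix (Fin k) (Fin k) ℂ) :
    hv.hom M = ∑ i, ∑ j, M i j • (v i * star (v j)) := rfl

/-- The coefficients of `Φ(M)` are recovered by compression. -/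
lemma compress_hom (hv : IsColumn v) (M : Matrix (Fin k) (Fin k) ℂ) (i j : Fin k) :
    star (v i) * hv.hom M * v j = M i j • v 0 := by
  have h0 : v 0 * v 0 = v 0 := hv.isStarProjection.isIdempotentElem.eq
  have key : ∀ a b, star (v i) * (v a * star (v b)) * v j =
      if i = a then (if b = j then v 0 else 0) else 0 := fun a b => by
    rw [← mul_assoc, hv, mul_assoc, hv]
    split_ifs <;> simp [h0]
  simp only [hom_apply, Finset.mul_sum, Finset.sum_mul, mul_smul_comm, smul_mul_assoc, key]
  simp

lemma hom_injective (hv : IsColumn v) (h0 : v 0 ≠ 0) : Function.Injective hv.hom := by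
  intro M N hMN
  ext i j
  have := hv.compress_hom M i j
  rw [hMN, hv.compress_hom] at this
  exact (smul_left_injective ℂ h0 this).symm

end IsColumn

/-- The column of matrix units of a *-homomorphism on `M_k(ℂ)`. -/
def column (Φ : Matrix (Fin k) (Fin k) ℂ →⋆ₙₐ[ℂ] A) (i : Fin k) : A := Φ (Matrix.single i 0 1)

lemma isColumn_column (Φ : Matrix (Fin k) (Fin k) ℂ →⋆ₙₐ[ℂ] A) : IsColumn (column Φ) := by
  intro i j
  rw [column, column, ← map_star, ← map_mul, Matrix.star_eq_conjTranspose,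
    Matrix.conjTranspose_single, star_one]
  split_ifs with h
  · rw [h, Matrix.single_mul_single_same, one_mul, column]
  · rw [Matrix.single_mul_single_of_ne _ _ _ _ h, map_zero]

/-- Because e_{ij} = e_{i0} e_{j0}*, a *-homomorphism is recovered from its column. Quantifying over
copies thus amounts to quantifying over k-tuples of elements. -/
lemma hom_column (Φ : Matrix (Fin k) (Fin k) ℂ →⋆ₙₐ[ℂ] A) (M : Matrix (Fin k) (Fin k) ℂ) :
    (isColumn_column Φ).hom M = Φ M := by
  conv_rhs => rw [Matrix.matrix_eq_sum_single M]
  rw [IsColumn.hom_apply, map_sum]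
  refine Finset.sum_congr rfl fun i _ => ?_
  rw [map_sum]
  refine Finset.sum_congr rfl fun j _ => ?_
  rw [column, column, ← map_star, ← map_mul, Matrix.star_eq_conjTranspose,
    Matrix.conjTranspose_single, star_one, Matrix.single_mul_single_same, one_mul, ← map_smul,
    Matrix.smul_single, smul_eq_mul, mul_one]

lemma column_zero_ne_zero {Φ : Matrix (Fin k) (Fin k) ℂ →⋆ₙₐ[ℂ] A} (hΦ : Function.Injective Φ) :
    column Φ 0 ≠ 0 := by
  rw [column, Ne, ← map_zero Φ, hΦ.eq_iff]
  intro h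
  simpa using congrFun (congrFun h 0) 0

/-- A *-homomorphism on `M_k(ℂ)` is injective or zero. -/
lemma injective_or_eq_zero (Φ : Matrix (Fin k) (Fin k) ℂ →⋆ₙₐ[ℂ] A) :
    Function.Injective Φ ∨ ∀ M, Φ M = 0 := by
  by_cases h : column Φ 0 = 0
  · refine .inr fun M => ?_
    have hc := isColumn_column Φ
    have : ∀ i, column Φ i = 0 := fun i => by rw [← hc.mul_zero_eq, h, mul_zero]
    rw [← hom_column, hc.hom_apply]
    simp [this]
  · left
    have : (Φ : _ → A) = (isColumn_column Φ).hom := funext fun M => (hom_column Φ M).symm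
    rw [this]
    exact (isColumn_column Φ).hom_injective h

end
-- Norm conditions for scalars in a corner and for membership in a copy
section
variable {A : Type*} [NonUnitalCStarAlgebra A]

/-- A self-adjoint element `h` of a corner `pAp` with `‖4p + h‖ + ‖4p - h‖ ≤ 8 + δ` is within `δ`
of a multiple of `p`: the maximum of its spectrum is `‖4p + h‖ - 4` and the minimum is
`4 - ‖4p - h‖`, provided that `‖h‖ ≤ 4`. -/
lemma exists_norm_sub_smul_le_of_isSelfAdjoint {p h : A} (hp : IsStarProjection p)
    (hh : IsSelfAdjoint h) (hph : p * h = h) {δ : ℝ} (hδ : 0 ≤ δ)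
    (hd : ‖(4 : ℂ) • p + h‖ + ‖(4 : ℂ) • p - h‖ ≤ 8 + δ) : ∃ t : ℝ, ‖h - (t : ℂ) • p‖ ≤ δ := by
  let := CStarAlgebra.spectralOrder A
  have := CStarAlgebra.spectralOrderedRing A
  have hps : star p = p := hp.isSelfAdjoint.star_eq
  have hpp : p * p = p := hp.isIdempotentElem.eq
  have hhp : h * p = h := by
    have := congrArg star hph
    rwa [star_mul, hps, hh.star_eq] at this
  have hp0 : 0 ≤ p := by rw [← hpp]; nth_rw 1 [← hps]; exact star_mul_self_nonneg p
  -- In place of a ≤ ‖a‖ · 1, which needs a unit: compressing by `p` gives a = pap ≤ ‖a‖ p.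
  have bound : ∀ a : A, IsSelfAdjoint a → p * a = a → a * p = a → a ≤ ‖a‖ • p := fun a h1 h2 h3 => by
    have := CStarAlgebra.star_left_conjugate_le_norm_smul (a := p) (b := a) h1
    rwa [hps, hpp, h2, h3] at this
  have e4 : (4 : ℂ) • p = (4 : ℝ) • p := by
    rw [← Complex.coe_smul]; norm_num
  rw [e4] at hd
  have sa4 : IsSelfAdjoint ((4 : ℝ) • p) := (IsSelfAdjoint.all (4 : ℝ)).smul hp.isSelfAdjoint
  set a := (4 : ℝ) • p + h with ha
  set b := (4 : ℝ) • p - h with hb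
  have b1 := bound a (sa4.add hh) (by rw [ha, mul_add, mul_smul_comm, hpp, hph])
    (by rw [ha, add_mul, smul_mul_assoc, hpp, hhp])
  have b2 := bound b (sa4.sub hh) (by rw [hb, mul_sub, mul_smul_comm, hpp, hph])
    (by rw [hb, sub_mul, smul_mul_assoc, hpp, hhp])
  -- The bounds for `a` and `b` say (4 - ‖b‖) p ≤ h ≤ (‖a‖ - 4) p, and the two scalars differ by ‖a‖
  -- + ‖b‖ - 8 ≤ δ.
  refine ⟨4 - ‖b‖, ?_⟩
  rw [Complex.coe_smul]
  have lower : 0 ≤ h - (4 - ‖b‖) • p := by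
    have e : h - (4 - ‖b‖) • p = ‖b‖ • p - b := by rw [sub_smul]; nth_rw 3 [hb]; abel
    rw [e]; exact sub_nonneg.2 b2
  have upper : h - (4 - ‖b‖) • p ≤ δ • p := by
    have e : δ • p - (h - (4 - ‖b‖) • p) =
        (‖a‖ • p - a) + (8 + δ - (‖a‖ + ‖b‖)) • p := by
      have e8 : (8 : ℝ) • p = (4 : ℝ) • p + (4 : ℝ) • p := by rw [← add_smul]; norm_num
      nth_rw 2 [ha]
      simp only [sub_smul, add_smul, e8]
      abel
    rw [← sub_nonneg, e]
    exact add_nonneg (sub_nonneg.2 b1) (smul_nonneg (by linarith) hp0)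
  calc _ ≤ ‖δ • p‖ := CStarAlgebra.norm_le_norm_of_nonneg_of_le lower upper
    _ ≤ δ := by
      rw [norm_smul, Real.norm_of_nonneg hδ]
      exact mul_le_of_le_one_right hδ (IsStarProjection.norm_le p hp)

/-- The analogue of `exists_norm_sub_smul_le_of_isSelfAdjoint` for arbitrary elements of `pAp`. -/
lemma exists_norm_sub_smul_le {p z : A} (hp : IsStarProjection p) (hpz : p * z = z)
    (hzp : z * p = z) {δ : ℝ} (hδ : 0 ≤ δ)
    (h1 : ‖(4 : ℂ) • p + (z + star z)‖ + ‖(4 : ℂ) • p - (z + star z)‖ ≤ 8 + δ)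
    (h2 : ‖(4 : ℂ) • p + Complex.I • (z - star z)‖ +
      ‖(4 : ℂ) • p - Complex.I • (z - star z)‖ ≤ 8 + δ) : ∃ c : ℂ, ‖z - c • p‖ ≤ δ := by
  have hpz' : p * star z = star z := by
    have := congrArg star hzp
    rwa [star_mul, hp.isSelfAdjoint.star_eq] at this
  obtain ⟨t, ht⟩ := exists_norm_sub_smul_le_of_isSelfAdjoint hp (h := z + star z)
    (by rw [IsSelfAdjoint, star_add, star_star, add_comm]) (by rw [mul_add, hpz, hpz']) hδ h1
  obtain ⟨s, hs⟩ := exists_norm_sub_smul_le_of_isSelfAdjoint hp (h := Complex.I • (z - star z))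
    (by
      rw [IsSelfAdjoint, star_smul, star_sub, star_star, Complex.star_def, Complex.conj_I, neg_smul,
        ← smul_neg, neg_sub])
    (by rw [mul_smul_comm, mul_sub, hpz, hpz']) hδ h2
  -- Cartesian decomposition z = ½ ((z + z*) - i · i(z - z*)); each of the two parts contributes
  -- δ/2.
  refine ⟨(1 / 2 : ℂ) * (t - Complex.I * s), ?_⟩
  have e : z - ((1 / 2 : ℂ) * (t - Complex.I * s)) • p =
      (1 / 2 : ℂ) • ((z + star z - (t : ℂ) • p) -
        Complex.I • (Complex.I • (z - star z) - (s : ℂ) • p)) := by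
    simp only [smul_sub, smul_add, smul_smul, sub_smul, mul_sub]
    have : (1 / 2 : ℂ) * (Complex.I * Complex.I) = -(1 / 2) := by rw [Complex.I_mul_I]; ring
    rw [this]
    module
  rw [e, norm_smul]
  have h3 := norm_sub_le (z + star z - (t : ℂ) • p)
    (Complex.I • (Complex.I • (z - star z) - (s : ℂ) • p))
  rw [norm_smul, Complex.norm_I, one_mul] at h3
  have h4 : ‖(1 / 2 : ℂ)‖ = 1 / 2 := by norm_num
  rw [h4]
  linarith

/-- Measures how far `z` is from being a scalar multiple of the projection `p`. -/
noncomputable def scalarDefect (p z : A) : ℝ≥0 :=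
  (‖(4 : ℂ) • p + (z + star z)‖₊ + ‖(4 : ℂ) • p - (z + star z)‖₊ - 8) +
    (‖(4 : ℂ) • p + Complex.I • (z - star z)‖₊ + ‖(4 : ℂ) • p - Complex.I • (z - star z)‖₊ - 8)

/-- For real t with |t| ≤ 4 one has ‖4p + tp‖ + ‖4p - tp‖ = 8‖p‖ ≤ 8, so the truncated difference is
0. The values of t that occur are 2 Re c and -2 Im c, of modulus at most 2. -/
lemma scalarDefect_smul {p : A} (hp : IsStarProjection p) {c : ℂ} (hc : ‖c‖ ≤ 1) :
    scalarDefect p (c • p) = 0 := by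
  have hps : star p = p := hp.isSelfAdjoint.star_eq
  have key : ∀ t : ℝ, |t| ≤ 4 → ‖(4 : ℂ) • p + (t : ℂ) • p‖₊ + ‖(4 : ℂ) • p - (t : ℂ) • p‖₊ ≤ 8 := by
    intro t ht
    obtain ⟨h1, h2⟩ := abs_le.1 ht
    rw [← NNReal.coe_le_coe]
    push_cast
    rw [← add_smul, ← sub_smul, norm_smul, norm_smul]
    have e1 : ‖(4 : ℂ) + t‖ = 4 + t := by
      rw [show (4 : ℂ) + t = ((4 + t : ℝ) : ℂ) by push_cast; ring, Complex.norm_real,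
        Real.norm_of_nonneg (by linarith)]
    have e2 : ‖(4 : ℂ) - t‖ = 4 - t := by
      rw [show (4 : ℂ) - t = ((4 - t : ℝ) : ℂ) by push_cast; ring, Complex.norm_real,
        Real.norm_of_nonneg (by linarith)]
    rw [e1, e2]
    have := IsStarProjection.norm_le p hp
    linarith
  have hre := (Complex.abs_re_le_norm c).trans hc
  have him := (Complex.abs_im_le_norm c).trans hc
  have e1 : c • p + star (c • p) = ((2 * c.re : ℝ) : ℂ) • p := by
    rw [star_smul, hps, ← add_smul, Complex.star_def, Complex.add_conj]
  have e2 : Complex.I • (c • p - star (c • p)) = ((-2 * c.im : ℝ) : ℂ) • p := by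
    rw [star_smul, hps, ← sub_smul, Complex.star_def, Complex.sub_conj, smul_smul]
    congr 1
    push_cast
    linear_combination (2 * (c.im : ℂ)) * Complex.I_mul_I
  rw [scalarDefect, e1, e2, tsub_eq_zero_of_le (key _ ?_), tsub_eq_zero_of_le (key _ ?_), add_zero]
  · rw [abs_mul, abs_neg, abs_two]; linarith
  · rw [abs_mul, abs_two]; linarith

/-- The corner relations hold for the exact pair `p`, `z`, whereas the defect is evaluated at the
approximate pair `q`, `w`. Passing between them changes each norm by at most 4s + 4s, and each sum
of two norms by 16s. -/
lemma exists_norm_sub_smul_le_of_scalarDefect {p q z w : A} (hp : IsStarProjection p)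
    (hpz : p * z = z) (hzp : z * p = z) {s : ℝ} (hq : ‖q - p‖ ≤ s) (hw : ‖w - z‖ ≤ 2 * s) :
    ∃ c : ℂ, ‖z - c • p‖ ≤ scalarDefect q w + 16 * s := by
  have hs : 0 ≤ s := (norm_nonneg _).trans hq
  have hw' : ‖star w - star z‖ ≤ 2 * s := by rwa [← star_sub, norm_star]
  have n4 : ‖(4 : ℂ)‖ = 4 := by norm_num
  have h4 : ‖(4 : ℂ) • (q - p)‖ ≤ 4 * s := by
    rw [norm_smul, n4]; linarith
  have pert : ∀ a b : A, ‖a - b‖ ≤ 4 * s →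
      ‖(4 : ℂ) • p + b‖ + ‖(4 : ℂ) • p - b‖ ≤
        8 + (((‖(4 : ℂ) • q + a‖₊ + ‖(4 : ℂ) • q - a‖₊ - 8 : ℝ≥0) : ℝ) + 16 * s) := by
    intro a b hab
    have t1 : ‖(4 : ℂ) • p + b‖ ≤ ‖(4 : ℂ) • q + a‖ + 8 * s := by
      have e : (4 : ℂ) • p + b = (4 : ℂ) • q + a - ((4 : ℂ) • (q - p) + (a - b)) := by
        rw [smul_sub]; abel
      rw [e]
      have := norm_sub_le ((4 : ℂ) • q + a) ((4 : ℂ) • (q - p) + (a - b))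
      have := norm_add_le ((4 : ℂ) • (q - p)) (a - b)
      linarith
    have t2 : ‖(4 : ℂ) • p - b‖ ≤ ‖(4 : ℂ) • q - a‖ + 8 * s := by
      have e : (4 : ℂ) • p - b = (4 : ℂ) • q - a - ((4 : ℂ) • (q - p) - (a - b)) := by
        rw [smul_sub]; abel
      rw [e]
      have := norm_sub_le ((4 : ℂ) • q - a) ((4 : ℂ) • (q - p) - (a - b))
      have := norm_sub_le ((4 : ℂ) • (q - p)) (a - b)
      linarith
    have t3 : ‖(4 : ℂ) • q + a‖ + ‖(4 : ℂ) • q - a‖ ≤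
        8 + ((‖(4 : ℂ) • q + a‖₊ + ‖(4 : ℂ) • q - a‖₊ - 8 : ℝ≥0) : ℝ) := by
      have := le_add_tsub (b := (8 : ℝ≥0)) (a := ‖(4 : ℂ) • q + a‖₊ + ‖(4 : ℂ) • q - a‖₊)
      exact_mod_cast this
    linarith
  have d1 : ‖w + star w - (z + star z)‖ ≤ 4 * s := by
    rw [add_sub_add_comm]
    have := norm_add_le (w - z) (star w - star z)
    linarith
  have d2 : ‖Complex.I • (w - star w) - Complex.I • (z - star z)‖ ≤ 4 * s := by
    rw [← smul_sub, norm_smul, Complex.norm_I, one_mul, sub_sub_sub_comm]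
    have := norm_sub_le (w - z) (star w - star z)
    linarith
  refine exists_norm_sub_smul_le hp hpz hzp (by positivity) ((pert _ _ d1).trans ?_)
    ((pert _ _ d2).trans ?_)
  · rw [scalarDefect]
    push_cast
    gcongr
    exact le_add_of_nonneg_right (by positivity)
  · rw [scalarDefect]
    push_cast
    gcongr
    exact le_add_of_nonneg_left (by positivity)

variable {k n : ℕ} [NeZero k]

/-- Measures how far `x` is from being a nonzero column of matrix units. -/
noncomputable def columnDefect (x : Fin k → A) : ℝ≥0 :=
  (∑ i, ∑ j, ‖star (x i) * x j - if i = j then x 0 else 0‖₊) + (∑ i, ‖x i * x 0 - x i‖₊) +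
    (1 - ‖x 0‖₊)

/-- Measures how far `y` is from belonging to the algebra generated by the column `x`. -/
noncomputable def spanDefect (x : Fin k → A) (y : A) : ℝ≥0 :=
  ‖y - ∑ i, ∑ j, x i * (star (x i) * y * x j) * star (x j)‖₊ +
    ∑ i, ∑ j, scalarDefect (x 0) (star (x i) * y * x j)

/-- Measures how far `x` is from being a column of matrix units whose span contains the `y_l`. -/
noncomputable def copyDefect (x : Fin k → A) (y : Fin n → A) : ℝ≥0 :=
  columnDefect x + ∑ l, spanDefect x (y l)

lemma columnDefect_column {Φ : Matrix (Fin k) (Fin k) ℂ →⋆ₙₐ[ℂ] A} (hΦ : Function.Injective Φ) :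
    columnDefect (column Φ) = 0 ∧ ‖column Φ 0‖ = 1 := by
  have hc := isColumn_column Φ
  have h1 : ‖column Φ 0‖ = 1 := by
    have h := CStarRing.norm_star_mul_self (x := column Φ 0)
    rw [hc, if_pos rfl] at h
    exact (mul_left_cancel₀ (norm_ne_zero_iff.2 (column_zero_ne_zero hΦ)) (by rw [← h, mul_one]))
  have h2 : ‖column Φ 0‖₊ = 1 := NNReal.eq h1
  refine ⟨?_, h1⟩
  simp only [columnDefect, hc _ _, hc.mul_zero_eq, sub_self, h2, nnnorm_zero,
    Finset.sum_const_zero, add_zero, tsub_self]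

/-- The norm bound enters through the coefficients: compression by contractions gives |M_ij| ≤ ‖Φ M‖
≤ 1, the range covered by `scalarDefect_smul`. -/
lemma spanDefect_column {Φ : Matrix (Fin k) (Fin k) ℂ →⋆ₙₐ[ℂ] A} (hΦ : Function.Injective Φ)
    {M : Matrix (Fin k) (Fin k) ℂ} (hM : ‖Φ M‖ ≤ 1) : spanDefect (column Φ) (Φ M) = 0 := by
  have hc := isColumn_column Φ
  have hz : ∀ i j, star (column Φ i) * Φ M * column Φ j = M i j • column Φ 0 := fun i j => by
    rw [← hom_column, hc.compress_hom]
  have hn : ∀ i j, ‖M i j‖ ≤ 1 := fun i j => by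
    have h1 := congrArg norm (hz i j)
    rw [norm_smul, (columnDefect_column hΦ).2, mul_one] at h1
    rw [← h1]
    refine (norm_mul_le _ _).trans (mul_le_one₀ ((norm_mul_le _ _).trans
      (mul_le_one₀ ?_ (norm_nonneg _) hM)) (norm_nonneg _) (hc.norm_le_one j))
    rw [norm_star]; exact hc.norm_le_one i
  have he : ∑ i, ∑ j, column Φ i * (M i j • column Φ 0) * star (column Φ j) = Φ M := by
    rw [← hom_column Φ M, hc.hom_apply]
    simp only [mul_smul_comm, smul_mul_assoc, hc.mul_zero_eq]
  simp only [spanDefect, hz, he, scalarDefect_smul hc.isStarProjection (hn _ _), sub_self,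
    nnnorm_zero, Finset.sum_const_zero, add_zero]

lemma copyDefect_column {Φ : Matrix (Fin k) (Fin k) ℂ →⋆ₙₐ[ℂ] A} (hΦ : Function.Injective Φ)
    {M : Fin n → Matrix (Fin k) (Fin k) ℂ} (hM : ∀ l, ‖Φ (M l)‖ ≤ 1) :
    copyDefect (column Φ) (fun l => Φ (M l)) = 0 := by
  simp only [copyDefect, (columnDefect_column hΦ).1, spanDefect_column hΦ (hM _),
    Finset.sum_const_zero, add_zero]

lemma norm_mul_mul_sub_mul_mul_le {a b c a' b' c' : A} {α β γ : ℝ} (hb : ‖b‖ ≤ 1)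
    (hb' : ‖b'‖ ≤ 1) (hc : ‖c‖ ≤ 1) (ha' : ‖a'‖ ≤ 1) (h1 : ‖a - a'‖ ≤ α) (h2 : ‖b - b'‖ ≤ β)
    (h3 : ‖c - c'‖ ≤ γ) : ‖a * b * c - a' * b' * c'‖ ≤ α + β + γ := by
  have e : a * b * c - a' * b' * c' =
      (a - a') * b * c + a' * (b - b') * c + a' * b' * (c - c') := by
    simp only [sub_mul, mul_sub]; abel
  have hα := (norm_nonneg _).trans h1
  have hβ := (norm_nonneg _).trans h2
  rw [e]
  have t1 : ‖(a - a') * b * c‖ ≤ α * 1 * 1 :=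
    (norm_mul_le _ _).trans (by gcongr; exact (norm_mul_le _ _).trans (by gcongr))
  have t2 : ‖a' * (b - b') * c‖ ≤ 1 * β * 1 :=
    (norm_mul_le _ _).trans (by gcongr; exact (norm_mul_le _ _).trans (by gcongr))
  have t3 : ‖a' * b' * (c - c')‖ ≤ 1 * 1 * γ :=
    (norm_mul_le _ _).trans (by gcongr; exact (norm_mul_le _ _).trans (by gcongr))
  have := norm_add₃_le (a := (a - a') * b * c) (b := a' * (b - b') * c) (c := a' * b' * (c - c'))
  linarith

lemma norm_mul_mul_le_one {a b c : A} (ha : ‖a‖ ≤ 1) (hb : ‖b‖ ≤ 1) (hc : ‖c‖ ≤ 1) :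
    ‖a * b * c‖ ≤ 1 :=
  (norm_mul_le _ _).trans (mul_le_one₀ ((norm_mul_le _ _).trans
    (mul_le_one₀ ha (norm_nonneg _) hb)) (norm_nonneg _) hc)

/-- The entries of `M` are the scalars that approximate v_i* y v_j. Each of the k² terms costs s +
2s + s for replacing `x` by `v` and 16s + r for replacing the compression by a scalar; the first
summand of `spanDefect` costs a further r. -/
lemma IsColumn.exists_norm_sub_hom_le {v x : Fin k → A} {y : A} (hv : IsColumn v)
    (hx : ∀ i, ‖x i‖ ≤ 1) (hy : ‖y‖ ≤ 1) {s r : ℝ} (hxv : ∀ i, ‖x i - v i‖ ≤ s)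
    (hr : spanDefect x y ≤ r) : ∃ M, ‖y - hv.hom M‖ ≤ r + k ^ 2 * (20 * s + r) := by
  have hp := hv.isStarProjection
  have hvn := hv.norm_le_one
  have hxs : ∀ i, ‖star (x i)‖ ≤ 1 := fun i => by rw [norm_star]; exact hx i
  have hvs : ∀ i, ‖star (v i)‖ ≤ 1 := fun i => by rw [norm_star]; exact hvn i
  have hxvs : ∀ i, ‖star (x i) - star (v i)‖ ≤ s := fun i => by
    rw [← star_sub, norm_star]; exact hxv i
  have hpz : ∀ i j, v 0 * (star (v i) * y * v j) = star (v i) * y * v j := fun i j => by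
    rw [← mul_assoc, ← mul_assoc, hv.zero_mul_star]
  have hzp : ∀ i j, star (v i) * y * v j * v 0 = star (v i) * y * v j := fun i j => by
    rw [mul_assoc, hv.mul_zero_eq]
  have hzz : ∀ i j, ‖star (x i) * y * x j - star (v i) * y * v j‖ ≤ 2 * s := fun i j => by
    have := norm_mul_mul_sub_mul_mul_le hy hy (hx j) (hvs i) (hxvs i)
      (by rw [sub_self, norm_zero] : ‖y - y‖ ≤ 0) (hxv j)
    linarith
  have hsd : ∀ i j, (scalarDefect (x 0) (star (x i) * y * x j) : ℝ) ≤ r := fun i j => by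
    refine le_trans ?_ hr
    rw [NNReal.coe_le_coe, spanDefect]
    refine le_trans ?_ (le_add_of_nonneg_left zero_le)
    refine le_trans ?_ (Finset.single_le_sum (fun _ _ => zero_le) (Finset.mem_univ i))
    exact Finset.single_le_sum (f := fun j => scalarDefect (x 0) (star (x i) * y * x j))
      (fun _ _ => zero_le) (Finset.mem_univ j)
  choose M hM using fun i j => exists_norm_sub_smul_le_of_scalarDefect hp (hpz i j) (hzp i j)
    (hxv 0) (hzz i j)
  have hfirst : ‖y - ∑ i, ∑ j, x i * (star (x i) * y * x j) * star (x j)‖ ≤ r := by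
    refine le_trans ?_ hr
    rw [← coe_nnnorm, NNReal.coe_le_coe, spanDefect]
    exact le_add_of_nonneg_right zero_le
  have hterm : ∀ i j, ‖x i * (star (x i) * y * x j) * star (x j) -
      M i j • (v i * star (v j))‖ ≤ 20 * s + r := fun i j => by
    have e : x i * (star (x i) * y * x j) * star (x j) - M i j • (v i * star (v j)) =
        (x i * (star (x i) * y * x j) * star (x j) - v i * (star (v i) * y * v j) * star (v j)) +
          v i * (star (v i) * y * v j - M i j • v 0) * star (v j) := by
      rw [mul_sub, sub_mul, mul_smul_comm, hv.mul_zero_eq, smul_mul_assoc]; abel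
    rw [e]
    have t1 := norm_mul_mul_sub_mul_mul_le (norm_mul_mul_le_one (hxs i) hy (hx j))
      (norm_mul_mul_le_one (hvs i) hy (hvn j)) (hxs j) (hvn i) (hxv i) (hzz i j) (hxvs j)
    have t2 : ‖v i * (star (v i) * y * v j - M i j • v 0) * star (v j)‖ ≤ 1 * (r + 16 * s) * 1 := by
      have := (hM i j).trans (add_le_add_left (hsd i j) _)
      have h0 := (norm_nonneg _).trans this
      exact (norm_mul_le _ _).trans (by
        gcongr; exacts [(norm_mul_le _ _).trans (by gcongr; exact hvn i), hvs j])
    refine (norm_add_le _ _).trans ?_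
    linarith
  refine ⟨Matrix.of M, ?_⟩
  have e : y - hv.hom (Matrix.of M) = (y - ∑ i, ∑ j, x i * (star (x i) * y * x j) * star (x j)) +
      ∑ i, ∑ j, (x i * (star (x i) * y * x j) * star (x j) - M i j • (v i * star (v j))) := by
    rw [hv.hom_apply]
    simp only [Finset.sum_sub_distrib, Matrix.of_apply]
    abel
  rw [e]
  refine (norm_add_le _ _).trans (add_le_add hfirst ?_)
  refine (norm_sum_le_of_le _ fun i _ => norm_sum_le_of_le _ fun j _ => hterm i j).trans (le_of_eq ?_)
  simp only [Finset.sum_const, Finset.card_univ, Fintype.card_fin, nsmul_eq_mul]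
  ring

end

/-- Stability of copies of `M_k(ℂ)` together with elements of them, uniformly in all algebras. -/
lemma exists_copy_near (k : ℕ) [NeZero k] : ∃ K : ℝ≥0, ∀ (A : Type u) [NonUnitalCStarAlgebra A]
    (n : ℕ) (x : Fin k → A) (y : Fin n → A), (∀ i, ‖x i‖ ≤ 1) → (∀ l, ‖y l‖ ≤ 1) →
      1 ≤ K * copyDefect x y ∨ ∃ Φ : Matrix (Fin k) (Fin k) ℂ →⋆ₙₐ[ℂ] A, Function.Injective Φ ∧
        ∀ l, ∃ M, ‖(2 : ℂ) • y l - Φ M‖ ≤ K * copyDefect x y := by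
  obtain ⟨K, hK, h⟩ := exists_isColumn_near.{u} k
  lift K to ℝ≥0 using zero_le_one.trans hK
  -- With s = K r and K ≥ 1, twice the bound r + k²(20 K r + r) is at most 44 k² K r. The factor 2
  -- comes from approximating 2 y_l.
  refine ⟨44 * k ^ 2 * K, fun A _ n x y hx hy => or_iff_not_imp_left.2 fun hlt => ?_⟩
  rw [not_le] at hlt
  set r := copyDefect x y with hr
  have hk : (1 : ℝ) ≤ k := by exact_mod_cast NeZero.one_le
  have hk2 : (1 : ℝ) ≤ (k : ℝ) ^ 2 := one_le_pow₀ hk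
  have hlt' : 44 * (k : ℝ) ^ 2 * K * r < 1 := by exact_mod_cast hlt
  have hr0 : (0 : ℝ) ≤ r := r.2
  have hrK : (r : ℝ) ≤ K * r := le_mul_of_one_le_left hr0 hK
  have hKk : (K * r : ℝ) ≤ k ^ 2 * (K * r) := le_mul_of_one_le_left (by positivity) hk2
  have hKr : (K * r : ℝ) ≤ 1 / 44 := by nlinarith
  have hcol : columnDefect x ≤ r := le_add_of_nonneg_right zero_le
  have hspan : ∀ l, spanDefect x (y l) ≤ r := fun l =>
    (Finset.single_le_sum (f := fun l => spanDefect x (y l)) (fun _ _ => zero_le)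
      (Finset.mem_univ l)).trans (le_add_of_nonneg_left zero_le)
  have c1 : ∀ i j, ‖star (x i) * x j - if i = j then x 0 else 0‖ ≤ r := fun i j => by
    rw [← coe_nnnorm, NNReal.coe_le_coe]
    refine le_trans ?_ hcol
    rw [columnDefect, add_assoc]
    refine le_trans ?_ (le_add_of_nonneg_right zero_le)
    refine le_trans ?_ (Finset.single_le_sum (fun _ _ => zero_le) (Finset.mem_univ i))
    exact Finset.single_le_sum (f := fun j => ‖star (x i) * x j - if i = j then x 0 else 0‖₊)
      (fun _ _ => zero_le) (Finset.mem_univ j)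
  have c2 : ∀ i, ‖x i * x 0 - x i‖ ≤ r := fun i => by
    rw [← coe_nnnorm, NNReal.coe_le_coe]
    refine le_trans ?_ hcol
    rw [columnDefect]
    refine le_trans ?_ (le_add_of_nonneg_right zero_le)
    refine le_trans ?_ (le_add_of_nonneg_left zero_le)
    exact Finset.single_le_sum (f := fun i => ‖x i * x 0 - x i‖₊)
      (fun _ _ => zero_le) (Finset.mem_univ i)
  have c3 : 1 ≤ ‖x 0‖ + r := by
    have : 1 ≤ ‖x 0‖₊ + r := le_add_tsub.trans
      (add_le_add_right ((le_add_of_nonneg_left zero_le).trans hcol) _)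
    exact_mod_cast this
  obtain ⟨v, hv, hxv⟩ := h A x r hx c1 c2 (by linarith)
  -- The term 1 - ‖x 0‖ of `columnDefect` serves to exclude the zero column: v 0 = 0 would give 1 ≤
  -- K r + r ≤ 2/44.
  have hv0 : v 0 ≠ 0 := by
    intro h0
    have := hxv 0
    rw [h0, sub_zero] at this
    linarith
  refine ⟨hv.hom, hv.hom_injective hv0, fun l => ?_⟩
  obtain ⟨M, hM⟩ := hv.exists_norm_sub_hom_le hx (hy l) hxv (NNReal.coe_le_coe.2 (hspan l))
  refine ⟨(2 : ℂ) • M, ?_⟩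
  rw [map_smul, ← smul_sub, norm_smul, Complex.norm_ofNat]
  push_cast
  nlinarith

/-! ### Terms and formulas expressing the defects -/

namespace StarPoly

variable {N : ℕ}

/-- The difference of two terms. -/
def sub (s t : StarPoly N) : StarPoly N := s.add (t.smul (-1))

/-- The sum of a finite family of terms. -/
noncomputable def sum {ι : Type*} [Fintype ι] (t : ι → StarPoly N) : StarPoly N :=
  (Finset.univ.toList.map t).foldr add zero

variable {A : Type*} [NonUnitalCStarAlgebra A] (c : Fin N → A)

lemma eval_sub (s t : StarPoly N) : (s.sub t).eval c = s.eval c - t.eval c := by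
  simp [sub, eval, sub_eq_add_neg]

lemma eval_sum {ι : Type*} [Fintype ι] (t : ι → StarPoly N) :
    (sum t).eval c = ∑ i, (t i).eval c := by
  rw [← Finset.sum_map_toList, sum]
  induction (Finset.univ : Finset ι).toList with
  | nil => simp [eval]
  | cons i l ih => simp [eval, ih]

lemma eval_ite (p : Prop) [Decidable p] (s t : StarPoly N) :
    (if p then s else t).eval c = if p then s.eval c else t.eval c :=
  apply_ite (fun s : StarPoly N => s.eval c) p s t

end StarPoly

namespace Formula

variable {N : ℕ}

/-- The sum of two formulas. -/
noncomputable def add (φ ψ : Formula N) : Formula N :=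
  conn ⟨fun p => p.1 + p.2, by fun_prop⟩ φ ψ

/-- The maximum of two formulas. -/
noncomputable def max (φ ψ : Formula N) : Formula N :=
  conn ⟨fun p => Max.max p.1 p.2, by fun_prop⟩ φ ψ

/-- The truncation of a formula at `1`. -/
noncomputable def truncate (φ : Formula N) : Formula N :=
  conn ⟨fun p => min 1 p.1, by fun_prop⟩ φ φ

/-- The truncated difference of a formula and a constant. -/
noncomputable def subConst (φ : Formula N) (c : ℝ≥0) : Formula N :=
  conn ⟨fun p => p.1 - c, by fun_prop⟩ φ φ

/-- The truncated difference of a constant and a formula. -/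
noncomputable def constSub (c : ℝ≥0) (φ : Formula N) : Formula N :=
  conn ⟨fun p => c - p.1, by fun_prop⟩ φ φ

/-- A constant multiple of a formula. -/
noncomputable def scale (c : ℝ≥0) (φ : Formula N) : Formula N :=
  conn ⟨fun p => c * p.1, by fun_prop⟩ φ φ

/-- The sum of a finite family of formulas. -/
noncomputable def sum {ι : Type*} [Fintype ι] (φ : ι → Formula N) : Formula N :=
  (Finset.univ.toList.map φ).foldr add (atomic .zero)

/-- The maximum of a finite family of formulas. -/
noncomputable def sup {ι : Type*} [Fintype ι] (φ : ι → Formula N) : Formula N :=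
  (Finset.univ.toList.map φ).foldr max (atomic .zero)

/-- The infimum over the unit ball with respect to the last `m` variables. -/
noncomputable def infUnitBalls : (m : ℕ) → Formula (N + m) → Formula N
  | 0, φ => φ
  | m + 1, φ => infUnitBalls m (infBall 1 φ)

variable {A : Type*} [NonUnitalCStarAlgebra A]

lemma eval_add (φ ψ : Formula N) (c : Fin N → A) : (φ.add ψ).eval c = φ.eval c + ψ.eval c := rfl

lemma eval_truncate (φ : Formula N) (c : Fin N → A) : φ.truncate.eval c = min 1 (φ.eval c) := rfl

lemma eval_subConst (φ : Formula N) (r : ℝ≥0) (c : Fin N → A) :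
    (φ.subConst r).eval c = φ.eval c - r := rfl

lemma eval_constSub (φ : Formula N) (r : ℝ≥0) (c : Fin N → A) :
    (constSub r φ).eval c = r - φ.eval c := rfl

lemma eval_scale (φ : Formula N) (r : ℝ≥0) (c : Fin N → A) :
    (scale r φ).eval c = r * φ.eval c := rfl

lemma eval_sum {ι : Type*} [Fintype ι] (φ : ι → Formula N) (c : Fin N → A) :
    (sum φ).eval c = ∑ i, (φ i).eval c := by
  rw [← Finset.sum_map_toList, sum]
  induction (Finset.univ : Finset ι).toList with
  | nil => simp [eval, StarPoly.eval]
  | cons i l ih => simp [eval_add, ih]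

lemma eval_sup_le_iff {ι : Type*} [Fintype ι] (φ : ι → Formula N) (c : Fin N → A) {r : ℝ≥0} :
    (sup φ).eval c ≤ r ↔ ∀ i, (φ i).eval c ≤ r := by
  have : ∀ l : List ι, ((l.map φ).foldr max (atomic .zero)).eval c ≤ r ↔
      ∀ i ∈ l, (φ i).eval c ≤ r := fun l => by
    induction l with
    | nil => simp [eval, StarPoly.eval]
    | cons i l ih =>
      rw [List.map_cons, List.foldr_cons, List.forall_mem_cons, ← ih]
      exact max_le_iff
  rw [sup, this]
  simp

lemma eval_infUnitBalls_le {m : ℕ} (φ : Formula (N + m)) (a : Fin N → A) (w : Fin m → A)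
    (hw : ∀ i, ‖w i‖ ≤ 1) : (infUnitBalls m φ).eval a ≤ φ.eval (Fin.append a w) := by
  induction m with
  | zero =>
    rw [show w = Fin.elim0 from Subsingleton.elim _ _, Fin.append_elim0]
    exact le_rfl
  | succ m ih =>
    rw [← Fin.snoc_init_self (α := fun _ => A) w, Fin.append_snoc]
    refine (ih (infBall 1 φ) (Fin.init w) fun i => hw _).trans ?_
    exact ciInf_le (OrderBot.bddBelow _)
      (⟨w (Fin.last m), by simpa using hw _⟩ : {x : A // ‖x‖ ≤ (1 : ℕ)})

lemma le_eval_infUnitBalls {m : ℕ} (φ : Formula (N + m)) (a : Fin N → A) {r : ℝ≥0}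
    (h : ∀ w : Fin m → A, (∀ i, ‖w i‖ ≤ 1) → r ≤ φ.eval (Fin.append a w)) :
    r ≤ (infUnitBalls m φ).eval a := by
  induction m with
  | zero =>
    have := h Fin.elim0 fun i => i.elim0
    rwa [Fin.append_elim0] at this
  | succ m ih =>
    refine ih (infBall 1 φ) fun w hw => ?_
    have : Nonempty {x : A // ‖x‖ ≤ (1 : ℕ)} := ⟨⟨0, by simp⟩⟩
    refine le_ciInf fun x => ?_
    have := h (Fin.snoc w x.1) fun i => by
      refine Fin.lastCases ?_ (fun j => ?_) i
      · simpa using x.2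
      · simpa using hw j
    rwa [Fin.append_snoc] at this

/-- The formula defining `scalarDefect`. -/
noncomputable def scalarDefect (p z : StarPoly N) : Formula N :=
  add
    (subConst (add (atomic ((p.smul 4).add (z.add z.adj)))
      (atomic ((p.smul 4).sub (z.add z.adj)))) 8)
    (subConst (add (atomic ((p.smul 4).add ((z.sub z.adj).smul Complex.I)))
      (atomic ((p.smul 4).sub ((z.sub z.adj).smul Complex.I)))) 8)

lemma eval_scalarDefect (p z : StarPoly N) (c : Fin N → A) :
    (scalarDefect p z).eval c = CStarLogic.scalarDefect (p.eval c) (z.eval c) := by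
  simp only [scalarDefect, eval_add, eval_subConst, eval, StarPoly.eval, StarPoly.eval_sub,
    CStarLogic.scalarDefect]

variable {k n : ℕ} [NeZero k]

/-- The formula defining `copyDefect`. -/
noncomputable def copyDefect (x : Fin k → StarPoly N) (y : Fin n → StarPoly N) : Formula N :=
  add
    (add
      (add
        (sum fun i => sum fun j =>
          atomic (((x i).adj.mul (x j)).sub (if i = j then x 0 else .zero)))
        (sum fun i => atomic (((x i).mul (x 0)).sub (x i))))
      (constSub 1 (atomic (x 0))))
    (sum fun l => add
      (atomic ((y l).sub (.sum fun i => .sum fun j =>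
        ((x i).mul (((x i).adj.mul (y l)).mul (x j))).mul (x j).adj)))
      (sum fun i => sum fun j => scalarDefect (x 0) (((x i).adj.mul (y l)).mul (x j))))

lemma eval_copyDefect (x : Fin k → StarPoly N) (y : Fin n → StarPoly N) (c : Fin N → A) :
    (copyDefect x y).eval c =
      CStarLogic.copyDefect (fun i => (x i).eval c) (fun l => (y l).eval c) := by
  simp only [copyDefect, eval_add, eval_sum, eval_constSub, eval_scalarDefect, eval,
    StarPoly.eval, StarPoly.eval_sub, StarPoly.eval_sum, StarPoly.eval_ite,
    CStarLogic.copyDefect, columnDefect, spanDefect]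

/-- The formula `max_l ‖a_l - 2 y_l‖ + K * copyDefect x y` in the variables `a, x, y`. -/
noncomputable def distToCopy (K : ℝ≥0) (k n : ℕ) [NeZero k] : Formula (n + (k + n)) :=
  add
    (sup fun l : Fin n => atomic ((StarPoly.var (Fin.castAdd (k + n) l)).sub
      ((StarPoly.var (Fin.natAdd n (Fin.natAdd k l))).smul 2)))
    (scale K (copyDefect (fun i : Fin k => .var (Fin.natAdd n (Fin.castAdd n i)))
      (fun l : Fin n => .var (Fin.natAdd n (Fin.natAdd k l)))))

/-- The hypothesis `hr` matters for n = 0: the right-hand side is then vacuous, while the formula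
still has the value K · `copyDefect`. -/
lemma eval_distToCopy_le_iff (K : ℝ≥0) (a : Fin n → A) (x : Fin k → A) (y : Fin n → A) {r : ℝ≥0}
    (hr : K * CStarLogic.copyDefect x y ≤ r) :
    (distToCopy K k n).eval (Fin.append a (Fin.append x y)) ≤ r ↔
      ∀ l, ‖a l - (2 : ℂ) • y l‖₊ + K * CStarLogic.copyDefect x y ≤ r := by
  have e : (distToCopy K k n).eval (Fin.append a (Fin.append x y)) =
      (sup fun l : Fin n => atomic ((StarPoly.var (Fin.castAdd (k + n) l)).sub
        ((StarPoly.var (Fin.natAdd n (Fin.natAdd k l))).smul 2))).eval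
          (Fin.append a (Fin.append x y)) + K * CStarLogic.copyDefect x y := by
    simp only [distToCopy, eval_add, eval_scale, eval_copyDefect, StarPoly.eval, Fin.append_left,
      Fin.append_right]
  rw [e, ← le_tsub_iff_right hr, eval_sup_le_iff]
  simp only [eval, StarPoly.eval_sub, StarPoly.eval, Fin.append_left, Fin.append_right,
    le_tsub_iff_right hr]

end Formula
-- The distance to copies of M_k(ℂ) as a formula
section

variable {A : Type*} [NonUnitalCStarAlgebra A] {k n : ℕ}

lemma le_matrixDist {a : Fin n → A} {r : ℝ} (h1 : r ≤ 1)
    (h : ∀ Φ : Matrix (Fin k) (Fin k) ℂ →⋆ₙₐ[ℂ] A, Function.Injective Φ →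
      r ≤ ⨆ i, Metric.infDist (a i) (Set.range Φ)) : r ≤ matrixDist k a := by
  refine le_csInf ⟨1, Set.mem_insert _ _⟩ ?_
  rintro _ (rfl | ⟨Φ, hΦ, rfl⟩)
  exacts [h1, h Φ hΦ]

lemma bddBelow_matrixDist (a : Fin n → A) :
    BddBelow (insert 1 {r : ℝ | ∃ Φ : Matrix (Fin k) (Fin k) ℂ →⋆ₙₐ[ℂ] A,
      Function.Injective Φ ∧ r = ⨆ i, Metric.infDist (a i) (Set.range Φ)}) := by
  refine ⟨0, ?_⟩
  rintro _ (rfl | ⟨Φ, -, rfl⟩)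
  exacts [zero_le_one, Real.iSup_nonneg fun _ => Metric.infDist_nonneg]

lemma matrixDist_le_one (a : Fin n → A) : matrixDist k a ≤ 1 :=
  csInf_le (bddBelow_matrixDist a) (Set.mem_insert _ _)

lemma matrixDist_le {a : Fin n → A} {Φ : Matrix (Fin k) (Fin k) ℂ →⋆ₙₐ[ℂ] A}
    (hΦ : Function.Injective Φ) {r : ℝ} (hr : 0 ≤ r) (h : ∀ i, ∃ M, ‖a i - Φ M‖ ≤ r) :
    matrixDist k a ≤ r := by
  refine (csInf_le (bddBelow_matrixDist a) (Set.mem_insert_of_mem _ ⟨Φ, hΦ, rfl⟩)).trans ?_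
  refine Real.iSup_le (fun i => ?_) hr
  obtain ⟨M, hM⟩ := h i
  refine (Metric.infDist_le_dist_of_mem (Set.mem_range_self M)).trans ?_
  rwa [dist_eq_norm]

lemma exists_norm_sub_lt_of_iSup_infDist_lt {a : Fin n → A}
    {Φ : Matrix (Fin k) (Fin k) ℂ →⋆ₙₐ[ℂ] A} {r : ℝ}
    (h : ⨆ i, Metric.infDist (a i) (Set.range Φ) < r) (i : Fin n) : ∃ M, ‖a i - Φ M‖ < r := by
  have h1 : Metric.infDist (a i) (Set.range Φ) < r :=
    (le_ciSup (Set.finite_range fun i => Metric.infDist (a i) (Set.range Φ)).bddAbove i).trans_lt h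
  obtain ⟨_, ⟨M, rfl⟩, hM⟩ := (Metric.infDist_lt_iff (Set.range_nonempty Φ)).1 h1
  exact ⟨M, by rwa [← dist_eq_norm]⟩

/-- Elements of the unit ball are approximated by elements `Φ(M)` of norm at most `2`. -/
lemma exists_norm_le_two_of_norm_sub_lt {a : A} (ha : ‖a‖ ≤ 1)
    {Φ : Matrix (Fin k) (Fin k) ℂ →⋆ₙₐ[ℂ] A} {r : ℝ} (h : ∃ M, ‖a - Φ M‖ < r) :
    ∃ M, ‖Φ M‖ ≤ 2 ∧ ‖a - Φ M‖ ≤ r := by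
  obtain ⟨M, hM⟩ := h
  by_cases h2 : ‖Φ M‖ ≤ 2
  · exact ⟨M, h2, hM.le⟩
  -- If ‖Φ M‖ > 2, then r > ‖a - Φ M‖ > 1 ≥ ‖a‖, so 0 approximates `a` well enough.
  · refine ⟨0, by simp, ?_⟩
    have := norm_sub_norm_le (Φ M) a
    rw [norm_sub_rev] at this
    rw [map_zero, sub_zero]
    linarith

/-- The distance to the zero subalgebra. -/
lemma matrixDist_zero {a : Fin n → A} (ha : ∀ i, ‖a i‖ ≤ 1) :
    (((Formula.sup fun i : Fin n => .atomic (.var i)).eval a : ℝ≥0) : ℝ) = matrixDist 0 a := by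
  refine le_antisymm (le_matrixDist ?_ fun Φ _ => ?_) (matrixDist_le (Φ := 0)
    (Function.injective_of_subsingleton _) (NNReal.coe_nonneg _) fun i => ⟨0, ?_⟩)
  · rw [← NNReal.coe_one, NNReal.coe_le_coe, Formula.eval_sup_le_iff]
    exact ha
  · have h0 : 0 ≤ ⨆ i, Metric.infDist (a i) (Set.range Φ) :=
      Real.iSup_nonneg fun _ => Metric.infDist_nonneg
    rw [← Real.coe_toNNReal _ h0, NNReal.coe_le_coe, Formula.eval_sup_le_iff]
    intro i
    rw [← NNReal.coe_le_coe, Real.coe_toNNReal _ h0]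
    refine le_of_forall_gt fun r hr => ?_
    obtain ⟨M, hM⟩ := exists_norm_sub_lt_of_iSup_infDist_lt hr i
    rw [Subsingleton.elim M 0, map_zero, sub_zero] at hM
    exact hM
  · rw [map_zero, sub_zero, ← coe_nnnorm, NNReal.coe_le_coe]
    exact (Formula.eval_sup_le_iff (fun i : Fin n => .atomic (.var i)) a).1 le_rfl i

end

/-- The distance to copies of `M_k(ℂ)` is given by a formula. -/
lemma exists_formula_eval_eq_matrixDist (k n : ℕ) : ∃ φ : Formula n,
    ∀ (A : Type u) [NonUnitalCStarAlgebra A] (a : Fin n → A), (∀ i, ‖a i‖ ≤ 1) →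
      ((φ.eval a : ℝ≥0) : ℝ) = matrixDist k a := by
  rcases Nat.eq_zero_or_pos k with rfl | hk
  · exact ⟨_, fun A _ a ha => matrixDist_zero ha⟩
  have : NeZero k := ⟨hk.ne'⟩
  obtain ⟨K, hK⟩ := exists_copy_near.{u} k
  -- Truncation at 1 gives the right value when there is no copy.
  refine ⟨(Formula.infUnitBalls (k + n) (Formula.distToCopy K k n)).truncate,
    fun A _ a ha => ?_⟩
  rw [Formula.eval_truncate]
  have hD0 : 0 ≤ matrixDist k a := le_matrixDist zero_le_one fun Φ _ =>
    Real.iSup_nonneg fun _ => Metric.infDist_nonneg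
  refine le_antisymm (le_matrixDist (by exact_mod_cast min_le_left _ _) fun Φ hΦ => ?_) ?_
  · refine (NNReal.coe_le_coe.2 (min_le_right _ _)).trans (le_of_forall_gt_imp_ge_of_dense ?_)
    intro r hr
    have hr0 : 0 ≤ r := (Real.iSup_nonneg fun _ => Metric.infDist_nonneg).trans hr.le
    lift r to ℝ≥0 using hr0
    choose M hM2 hM using fun i => exists_norm_le_two_of_norm_sub_lt (ha i)
      (exists_norm_sub_lt_of_iSup_infDist_lt hr i)
    -- The quantified y_l must lie in the unit ball, while the approximants have norm up to 2; hence
    -- the halving here and the factor 2 in `distToCopy`.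
    have hy : ∀ l, ‖Φ ((1 / 2 : ℂ) • M l)‖ ≤ 1 := fun l => by
      rw [map_smul, norm_smul]
      have : ‖(1 / 2 : ℂ)‖ = 1 / 2 := by norm_num
      rw [this]
      linarith [hM2 l]
    have hdef := copyDefect_column hΦ hy
    rw [NNReal.coe_le_coe]
    refine (Formula.eval_infUnitBalls_le _ a
      (Fin.append (column Φ) fun l => Φ ((1 / 2 : ℂ) • M l)) fun i => ?_).trans ?_
    · refine Fin.addCases (fun i => ?_) (fun l => ?_) i
      · rw [Fin.append_left]; exact (isColumn_column Φ).norm_le_one i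
      · rw [Fin.append_right]; exact hy l
    · rw [Formula.eval_distToCopy_le_iff _ _ _ _ (by rw [hdef, mul_zero]; exact zero_le)]
      intro l
      rw [hdef, mul_zero, add_zero, ← map_smul, smul_smul]
      norm_num
      exact hM l
  · lift matrixDist k a to ℝ≥0 using hD0 with D hD
    rw [NNReal.coe_le_coe]
    have hD1 : (D : ℝ) ≤ 1 := hD ▸ matrixDist_le_one a
    refine le_min (by exact_mod_cast hD1) (Formula.le_eval_infUnitBalls _ _ fun w hw => ?_)
    obtain ⟨x, y, rfl⟩ : ∃ x y, w = Fin.append x y :=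
      ⟨_, _, (Fin.append_castAdd_natAdd (f := w)).symm⟩
    have hx : ∀ i, ‖x i‖ ≤ 1 := fun i => by simpa using hw (Fin.castAdd n i)
    have hy : ∀ l, ‖y l‖ ≤ 1 := fun l => by simpa using hw (Fin.natAdd k l)
    set e := (Formula.distToCopy K k n).eval (Fin.append a (Fin.append x y)) with he
    have hKe : K * copyDefect x y ≤ e := by
      rw [he, Formula.distToCopy, Formula.eval_add, Formula.eval_scale, Formula.eval_copyDefect]
      simp only [StarPoly.eval, Fin.append_right, Fin.append_left]
      exact le_add_of_nonneg_left zero_le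
    have hle := (Formula.eval_distToCopy_le_iff K a x y hKe).1 he.ge
    -- Either the penalty alone is at least 1, which bounds the distance anyway, or it pays for
    -- moving from 2 y_l into a genuine copy.
    rcases hK A n x y hx hy with h1 | ⟨Φ, hΦ, h⟩
    · exact (show D ≤ 1 by exact_mod_cast hD1).trans (h1.trans hKe)
    · rw [← NNReal.coe_le_coe, hD]
      refine matrixDist_le hΦ e.2 fun l => ?_
      obtain ⟨M, hM⟩ := h l
      refine ⟨M, (norm_sub_le_norm_sub_add_norm_sub (a l) ((2 : ℂ) • y l) (Φ M)).trans ?_⟩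
      have : ‖a l - (2 : ℂ) • y l‖ + K * copyDefect x y ≤ e := by exact_mod_cast hle l
      linarith

/-! ### Local matriciality and omission of the types -/

section

variable {A : Type*} [NonUnitalCStarAlgebra A]

lemma isRealizedBy_farType_iff {β : ℕ → (n : ℕ) → Formula n}
    (hβ : ∀ (k n : ℕ) (a : Fin n → A), (∀ i, ‖a i‖ ≤ 1) →
      (((β k n).eval a : ℝ≥0) : ℝ) = matrixDist k a) {m n : ℕ} (a : Fin n → A) :
    (farType β m n).IsRealizedBy a ↔
      (∀ i, ‖a i‖ ≤ 1) ∧ ∀ k, 1 / (m : ℝ) ≤ matrixDist k a := by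
  refine and_congr_right fun ha => ⟨fun h k => ?_, fun h c hc => ?_⟩
  · have h1 : 1 / (m : ℝ≥0) ≤ (β k n).eval a := h _ (.inl ⟨k, rfl⟩)
    rw [← hβ k n a ha]
    exact_mod_cast h1
  · rcases hc with ⟨k, rfl⟩ | ⟨i, rfl⟩
    · have h1 := h k
      rw [← hβ k n a ha] at h1
      change 1 / (m : ℝ≥0) ≤ (β k n).eval a
      exact_mod_cast h1
    · exact ha i

/-- Two mismatches are reconciled. Local matriciality allows non-injective homomorphisms but
requires k ≥ 1, whereas copies are injective and k = 0 is allowed: the zero homomorphism and the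
copy of M_0(ℂ) replace each other. Arbitrary finite sets are scaled into the unit ball. -/
lemma locallyMatricial_iff : LocallyMatricial A ↔ ∀ m n : ℕ, 1 ≤ m → 1 ≤ n → ∀ a : Fin n → A,
    (∀ i, ‖a i‖ ≤ 1) → ∃ k, matrixDist k a < 1 / (m : ℝ) := by
  classical
  constructor
  · intro h m n hm _ a _
    have hm0 : (0 : ℝ) < m := by exact_mod_cast hm
    have hε : 0 < 1 / (2 * (m : ℝ)) := by positivity
    have hlt : 1 / (2 * (m : ℝ)) < 1 / m := by
      apply one_div_lt_one_div_of_lt hm0; linarith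
    obtain ⟨k, hk, Φ, hΦ⟩ := h (Finset.univ.image a) _ hε
    have hΦ' : ∀ i, ∃ M, ‖a i - Φ M‖ ≤ 1 / (2 * (m : ℝ)) := fun i =>
      (hΦ (a i) (Finset.mem_image_of_mem _ (Finset.mem_univ i))).imp fun _ => le_of_lt
    have : NeZero k := ⟨by omega⟩
    rcases injective_or_eq_zero Φ with hinj | h0
    · exact ⟨k, (matrixDist_le hinj hε.le hΦ').trans_lt hlt⟩
    · refine ⟨0, (matrixDist_le (Φ := 0) (Function.injective_of_subsingleton _) hε.le
        fun i => ⟨0, ?_⟩).trans_lt hlt⟩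
      obtain ⟨M, hM⟩ := hΦ' i
      rwa [map_zero, ← h0 M]
  · intro h F ε hε
    rcases F.eq_empty_or_nonempty with rfl | hF
    · exact ⟨1, le_rfl, 0, by simp⟩
    obtain ⟨R, hR1, hR⟩ : ∃ R : ℝ, 1 ≤ R ∧ ∀ b ∈ F, ‖b‖ ≤ R :=
      ⟨1 + ∑ b ∈ F, ‖b‖, le_add_of_nonneg_right (Finset.sum_nonneg fun _ _ => norm_nonneg _),
        fun b hb => (Finset.single_le_sum (f := fun b => ‖b‖) (fun _ _ => norm_nonneg _) hb).trans
          (le_add_of_nonneg_left zero_le_one)⟩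
    have hR0 : 0 < R := by linarith
    have hRn : ‖(R : ℂ)‖ = R := by rw [Complex.norm_real, Real.norm_of_nonneg hR0.le]
    have hRne : (R : ℂ) ≠ 0 := by exact_mod_cast hR0.ne'
    -- Undoing the scaling multiplies errors by `R`, hence the tolerance ε / R.
    obtain ⟨m, hm⟩ := exists_nat_one_div_lt (show 0 < ε / R by positivity)
    let a : Fin F.card → A := fun i => (R : ℂ)⁻¹ • (F.equivFin.symm i : A)
    have ha : ∀ i, ‖a i‖ ≤ 1 := fun i => by
      rw [norm_smul, norm_inv, hRn, inv_mul_le_iff₀ hR0, mul_one]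
      exact hR _ (F.equivFin.symm i).2
    obtain ⟨k, hk⟩ := h (m + 1) F.card (by omega) hF.card_pos a ha
    obtain ⟨r, hr, hrm⟩ := exists_lt_of_csInf_lt ⟨1, Set.mem_insert _ _⟩ hk
    have hm1 : 1 / ((m + 1 : ℕ) : ℝ) ≤ 1 := by
      rw [div_le_one (by positivity)]; push_cast; linarith [(Nat.cast_nonneg m : (0 : ℝ) ≤ m)]
    -- The default value 1 is excluded by 1 / (m + 1) ≤ 1, so a genuine copy is at hand.
    rcases hr with rfl | ⟨Φ, -, rfl⟩
    · linarith
    have key : ∀ b ∈ F, ∃ M, ‖b - Φ M‖ < ε := fun b hb => by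
      obtain ⟨M, hM⟩ := exists_norm_sub_lt_of_iSup_infDist_lt hrm (F.equivFin ⟨b, hb⟩)
      refine ⟨(R : ℂ) • M, ?_⟩
      have e : b - Φ ((R : ℂ) • M) = (R : ℂ) • (a (F.equivFin ⟨b, hb⟩) - Φ M) := by
        simp only [a, Equiv.symm_apply_apply, map_smul, smul_sub, smul_smul,
          mul_inv_cancel₀ hRne, one_smul]
      rw [e, norm_smul, hRn, mul_comm, ← lt_div_iff₀ hR0]
      refine hM.trans ?_
      push_cast
      exact hm
    rcases Nat.eq_zero_or_pos k with rfl | hk0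
    · refine ⟨1, le_rfl, 0, fun b hb => ⟨0, ?_⟩⟩
      obtain ⟨M, hM⟩ := key b hb
      rwa [Subsingleton.elim M 0, map_zero] at hM
    · exact ⟨k, hk0, Φ, key⟩

end

end CStarLogic

theorem theoremT :
    ∃ β : ℕ → (n : ℕ) → CStarLogic.Formula n,
      (∀ (k n : ℕ) (A : Type u) [NonUnitalCStarAlgebra A] (a : Fin n → A),
        (∀ i, ‖a i‖ ≤ 1) → (((β k n).eval a : ℝ≥0) : ℝ) = CStarLogic.matrixDist k a) ∧
      ∀ (A : Type u) [NonUnitalCStarAlgebra A] [TopologicalSpace.SeparableSpace A],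
        CStarLogic.LocallyMatricial A ↔
          ∀ m n : ℕ, 1 ≤ m → 1 ≤ n → CStarLogic.Omits A (CStarLogic.farType β m n) := by
  choose β hβ using CStarLogic.exists_formula_eval_eq_matrixDist.{u}
  refine ⟨β, hβ, fun A _ _ => ?_⟩
  rw [CStarLogic.locallyMatricial_iff]
  refine forall₄_congr fun m n _ _ => ?_
  simp only [CStarLogic.Omits,
    CStarLogic.isRealizedBy_farType_iff (fun k n a ha => hβ k n A a ha), not_exists, not_and,
    not_forall, not_le]
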